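/- Let $\mathcal T_h$ be a finite conforming triangulation of a polyhedral domain $\Omega\subset\mathbb R^3$ into nondegenerate tetrahedra. Write $h_T=\operatorname{diam}(T)$, and suppose that $\mathcal T_h$ is shape regular with constant $\sigma$, i.e. $h_T\le\sigma\rho_T$ for all $T\in\mathcal T_h$, where $\rho_T$ is the diameter of the ball inscribed in $T$. The Worsey–Farin refinement $\mathcal T_h^{\rm WF}$ splits each $T\in\mathcal T_h$ into twelve tetrahedra. On each face $F$ of $T$ a split point $m_F$ is chosen: if $F$ is shared with another tetrahedron $T'\in\mathcal T_h$, then $m_F$ is the intersection of $F$ with the segment joining the incenters of $T$ and $T'$; if $F$ is a boundary face, then $m_F$ is the barycenter of $F$. The twelve tetrahedra are the convex hulls of the incenter of $T$, the point $m_F$ and the edge $e$, where $F$ runs over the faces of $T$ and $e$ over the edges of $F$. Let $\boldsymbol V_h^{\rm WF}$ be the space of continuous vector fields $\boldsymbol v:\bar\Omega\to\mathbb R^3$ whose restriction to each $K\in\mathcal T_h^{\rm WF}$ is a polynomial of degree at most one. Then there is a constant $C>0$, depending only on $\sigma$, such that for all $\boldsymbol v\in\boldsymbol V_h^{\rm WF}$,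 all $T\in\mathcal T_h$ and $m=0,1$, $$ |\boldsymbol v|_{H^m(T)}^2\le C\,h_T^{-1-2m}\Big(h_T^4\sum_{a\in\Delta_0(T)}|\boldsymbol v(a)|^2+\sum_{F\in\Delta_2(T)}\Big|\int_F\boldsymbol v\cdot\boldsymbol n_F\Big|^2+h_T^3\,\|\operatorname{div}\boldsymbol v\|_{L^2(T)}^2\Big), $$ where $\Delta_0(T)$ and $\Delta_2(T)$ are the sets of vertices and of faces of $T$, $\boldsymbol n_F$ is the outward unit normal of $T$ on $F$, $|\boldsymbol v|_{H^0(T)}=\|\boldsymbol v\|_{L^2(T)}$ and $|\boldsymbol v|_{H^1(T)}=\|\nabla\boldsymbol v\|_{L^2(T)}$. -/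

import Mathlib

open MeasureTheory

namespace WorseyFarin

/-- Euclidean three-space. -/
abbrev E3 : Type := EuclideanSpace ℝ (Fin 3)

/-- A (nondegenerate, vertex-labelled) tetrahedron in `ℝ³`. -/
abbrev Tet : Type := Affine.Simplex ℝ E3 3

/-- A finite conforming simplicial triangulation: distinct members have distinct vertex sets, and
they meet exactly in the (possibly empty) simplex spanned by their common vertices. -/
structure TetMesh where
  /-- the tetrahedra of the triangulation -/
  tets : Set Tet
  finite_tets : tets.Finite
  vertices_ne : ∀ S ∈ tets, ∀ T ∈ tets, S ≠ T → Set.range S.points ≠ Set.range T.points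
  conforming : ∀ S ∈ tets, ∀ T ∈ tets, S ≠ T →
    S.closedInterior ∩ T.closedInterior =
      convexHull ℝ (Set.range S.points ∩ Set.range T.points)

/-- The closed polyhedral region that is triangulated by the mesh. -/
def TetMesh.region (M : TetMesh) : Set E3 := ⋃ T ∈ M.tets, T.closedInterior

/-- `h_T`, the diameter of the tetrahedron `T`. -/
noncomputable def hT (T : Tet) : ℝ := Metric.diam T.closedInterior

/-- Shape regularity with constant `σ`: the diameter of every tetrahedron is at most `σ` times
the diameter of its inscribed ball. -/
def TetMesh.ShapeRegular (M : TetMesh) (σ : ℝ) : Prop :=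
  ∀ T ∈ M.tets, hT T ≤ σ * (2 * T.inradius)

/-- The closed face of `T` opposite to the vertex with index `i`. -/
def face (T : Tet) (i : Fin 4) : Set E3 := (T.faceOpposite i).closedInterior

/-- `S` is the neighbour of `T` in the mesh across the face of `T` opposite to vertex `i`. -/
def TetMesh.IsNeighbor (M : TetMesh) (T : Tet) (i : Fin 4) (S : Tet) : Prop :=
  S ∈ M.tets ∧ S ≠ T ∧ ∀ j, j ≠ i → T.points j ∈ Set.range S.points

/-- `p` is the split point of the face of `T` opposite to vertex `i`. For a face shared with a
neighbour `S` it is the point where the segment joining the incenters of `T` and `S` meets the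
face; for a boundary face it is the barycenter of the face. -/
def TetMesh.IsFaceSplitPoint (M : TetMesh) (T : Tet) (i : Fin 4) (p : E3) : Prop :=
  (∃ S, M.IsNeighbor T i S ∧ p ∈ segment ℝ T.incenter S.incenter ∩ face T i) ∨
  ((¬ ∃ S, M.IsNeighbor T i S) ∧ p = T.faceOppositeCentroid i)

/-- The local Worsey–Farin split of `T`: the twelve tetrahedra whose vertices are the incenter of
`T`, the split point of a face of `T`, and the two endpoints of an edge of that face. Here `i` is
the vertex of `T` opposite to the face and the edge consists of the vertices other than `i`, `j`. -/
def TetMesh.localSplit (M : TetMesh) (T : Tet) : Set (Set E3) :=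
  {K | ∃ (i j : Fin 4) (p : E3), j ≠ i ∧ M.IsFaceSplitPoint T i p ∧
    K = convexHull ℝ (insert T.incenter (insert p (T.points '' {k | k ≠ i ∧ k ≠ j})))}

/-- The global Worsey–Farin refinement of the mesh. -/
def TetMesh.refinement (M : TetMesh) : Set (Set E3) := ⋃ T ∈ M.tets, M.localSplit T

/-- The Worsey–Farin linear Lagrange space: vector fields that are continuous on the triangulated
region and coincide with a polynomial vector field of degree at most one on each tetrahedron of the
Worsey–Farin refinement. Values outside the region are irrelevant. -/
def TetMesh.lagrangeSpace (M : TetMesh) : Set (E3 → E3) :=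
  {v | ContinuousOn v M.region ∧
    ∀ K ∈ M.refinement, ∃ A : E3 →ᵃ[ℝ] E3, Set.EqOn v A K}

/-- The partial derivative `∂_j v_i` at `x`. A continuous piecewise affine field is differentiable
in the region off a null set (a finite union of triangles), and its pointwise derivative there is its
weak derivative. -/
noncomputable def partialDeriv (v : E3 → E3) (i j : Fin 3) (x : E3) : ℝ :=
  (fderiv ℝ v x (EuclideanSpace.single j 1)) i

/-- The divergence of a vector field. -/
noncomputable def divergence (v : E3 → E3) (x : E3) : ℝ := ∑ i, partialDeriv v i i x

/-- The square of the `H^m(T)` seminorm of a vector field, for `m = 0, 1`. -/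
noncomputable def seminormSq (T : Tet) (v : E3 → E3) : Fin 2 → ℝ
  | 0 => ∫ x in T.closedInterior, ‖v x‖ ^ 2
  | 1 => ∫ x in T.closedInterior, ∑ i, ∑ j, partialDeriv v i j x ^ 2

/-- The outward unit normal of `T` on the face opposite to the vertex with index `i`: the unit
vector pointing from this vertex to the foot of its altitude. -/
noncomputable def outwardNormal (T : Tet) (i : Fin 4) : E3 :=
  (T.height i)⁻¹ • (T.altitudeFoot i - T.points i)

/-- The flux `∫_F v · n_F` through the face `F` of `T` opposite to the vertex with index `i`
(integral with respect to surface area). -/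
noncomputable def faceFlux (T : Tet) (v : E3 → E3) (i : Fin 4) : ℝ :=
  ∫ x in face T i, inner ℝ (v x) (outwardNormal T i) ∂μHE[2]

end WorseyFarin

/-! On one tetrahedron `T` the field is determined by its values at the vertices, at the incenter
`I` and at the four split points `p i`. So it suffices to bound `u = v I` and `z i = v (p i)` by the
vertex values, the fluxes and the divergence; inverse estimates then bound both seminorms. Write λ_j
for the barycentric coordinates of `T`, n_i for its normals, r for its inradius, and t_i = λ_i /
λ_i(I). On the subtetrahedron spanned by `I`, `p i` and the edge of face i opposite vertex j, the
divergence is a constant. Up to terms in the vertex values it equals dt_i(u) + dμ_ij(z_i), where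
μ_ij = (λ_j - λ_j(I) t_i) / λ_j(p_i). Each of these twelve constants is bounded by the L² norm of
the divergence, because the subtetrahedron contains a ball of size comparable to h_T
(`IsSplit.closedBall_subset`, `IsSplit.sq_sum_le`). The flux through face i controls n_i · z_i up to
vertex values (`IsSplit.abs_inner_le`), which is the same as dt_i(z_i) = -(n_i · z_i) / r. The
system is inverted in `IsSplit.norm_le`. Averaging the three constants of face i with the weights
λ_j(p_i) cancels the tangential part of z_i and leaves dt_i(u - z_i). Hence dt_i(u) is bounded for
every i, and this bounds u. Each single constant then bounds dλ_j(z_i), and so z_i. All constants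
are uniform as soon as λ_j(p_i) ≥ κ > 0 for j ≠ i, with κ depending only on σ. On a shared face the
split point lies between the two points where the inscribed balls touch the face
(`ShareFace.lineMap_incenter_eq`). At a contact point λ_j equals (r / h_j) |n_i - n_j|² / 2, where
h_j is the height over face j, and shape regularity bounds this from below (`le_bary_contact`).
Conformity puts the two tetrahedra on opposite sides of the face (`bary_neg_of_conforming`), so that
the segment of incenters does meet it. -/

namespace WorseyFarin

/-! ### Barycentric coordinates, faces and normals. -/

section Barycentric

/-- The vertices of a tetrahedron as an affine basis of `ℝ³`. -/
noncomputable def Tet.basis (T : Tet) : AffineBasis (Fin 4) ℝ E3 :=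
  ⟨T.points, T.independent, by
    rw [T.independent.affineSpan_eq_top_iff_card_eq_finrank_add_one]; simp⟩

/-- The barycentric coordinate of a tetrahedron belonging to the vertex `i`. -/
noncomputable def bary (T : Tet) (i : Fin 4) : E3 →ᵃ[ℝ] ℝ := T.basis.coord i

/-- The derivative of the barycentric coordinate belonging to the vertex `i`. -/
noncomputable def baryDeriv (T : Tet) (i : Fin 4) : E3 →ₗ[ℝ] ℝ := (bary T i).linear

lemma sum_bary (T : Tet) (x : E3) : ∑ i, bary T i x = 1 := T.basis.sum_coord_apply_eq_one x

lemma sum_bary_smul (T : Tet) (x : E3) : ∑ i, bary T i x • T.points i = x :=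
  T.basis.linear_combination_coord_eq_self x

lemma bary_point (T : Tet) (i j : Fin 4) : bary T i (T.points j) = if i = j then 1 else 0 :=
  T.basis.coord_apply i j

lemma bary_affineCombination (T : Tet) (i : Fin 4) (w : Fin 4 → ℝ) (hw : ∑ j, w j = 1) :
    bary T i (Finset.univ.affineCombination ℝ T.points w) = w i :=
  T.basis.coord_apply_combination_of_mem (Finset.mem_univ i) hw

lemma affineCombination_bary (T : Tet) (x : E3) :
    Finset.univ.affineCombination ℝ T.points (fun i => bary T i x) = x :=
  T.basis.affineCombination_coord_eq_self x

lemma bary_sum (T : Tet) (i : Fin 4) (w : Fin 4 → ℝ) (hw : ∑ j, w j = 1) :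
    bary T i (∑ j, w j • T.points j) = w i := by
  rw [← Finset.univ.affineCombination_eq_linear_combination _ _ hw, bary_affineCombination T i w hw]

lemma bary_sub (T : Tet) (i : Fin 4) (x y : E3) :
    bary T i x - bary T i y = baryDeriv T i (x - y) :=
  ((bary T i).linearMap_vsub x y).symm

lemma bary_add (T : Tet) (i : Fin 4) (x y : E3) :
    bary T i (x + y) = bary T i x + baryDeriv T i y := by
  have := bary_sub T i (x + y) x
  rw [add_sub_cancel_left] at this
  linarith

lemma sum_baryDeriv (T : Tet) (y : E3) : ∑ i, baryDeriv T i y = 0 := by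
  have h := sum_bary T (0 + y)
  simp only [bary_add, Finset.sum_add_distrib, sum_bary] at h
  linarith

lemma sum_baryDeriv_smul (T : Tet) (y : E3) : ∑ i, baryDeriv T i y • T.points i = y := by
  have h := sum_bary_smul T (0 + y)
  simp only [bary_add, add_smul, Finset.sum_add_distrib, sum_bary_smul] at h
  simpa using h

lemma sum_baryDeriv_smul_sub (T : Tet) (q y : E3) :
    ∑ i, baryDeriv T i y • (T.points i - q) = y := by
  simp only [smul_sub, Finset.sum_sub_distrib, sum_baryDeriv_smul, ← Finset.sum_smul,
    sum_baryDeriv, zero_smul, sub_zero]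

lemma mem_closedInterior_iff (T : Tet) (x : E3) :
    x ∈ T.closedInterior ↔ ∀ i, 0 ≤ bary T i x := by
  rw [← Affine.Simplex.convexHull_eq_closedInterior]
  exact Set.ext_iff.1 T.basis.convexHull_eq_nonneg_coord x

lemma mem_face_iff (T : Tet) (i : Fin 4) (x : E3) :
    x ∈ face T i ↔ (∀ j, 0 ≤ bary T j x) ∧ bary T i x = 0 := by
  have h := T.affineCombination_mem_closedInterior_face_iff_nonneg (fs := {i}ᶜ) (m := 2)
    (by simp [Finset.card_compl]) (sum_bary T x)
  rw [affineCombination_bary] at h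
  refine h.trans ⟨fun ⟨h1, h2⟩ => ?_, fun ⟨h1, h2⟩ => ⟨fun j _ => h1 j, fun j hj => ?_⟩⟩
  · have hi : bary T i x = 0 := h2 i (by simp)
    refine ⟨fun j => ?_, hi⟩
    by_cases hj : j = i
    · rw [hj, hi]
    · exact h1 j (by simpa using hj)
  · have : j = i := by simpa using hj
    rw [this, h2]

lemma face_subset (T : Tet) (i : Fin 4) : face T i ⊆ T.closedInterior := fun x hx =>
  (mem_closedInterior_iff T x).2 ((mem_face_iff T i x).1 hx).1

lemma continuous_bary (T : Tet) (i : Fin 4) : Continuous (bary T i) :=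
  (bary T i).continuous_of_finiteDimensional

lemma inner_outwardNormal_point_sub (T : Tet) {i j k : Fin 4} (hj : j ≠ i) (hk : k ≠ i) :
    inner ℝ (outwardNormal T i) (T.points j - T.points k) = 0 := by
  have h1 := T.inner_vsub_altitudeFoot_vsub_altitudeFoot_eq_zero hj.symm
  have h2 := T.inner_vsub_altitudeFoot_vsub_altitudeFoot_eq_zero hk.symm
  simp only [vsub_eq_sub] at h1 h2
  rw [outwardNormal, real_inner_smul_left, ← neg_sub (T.points i), inner_neg_left,
    real_inner_comm,
    show T.points j - T.points k = (T.points j - T.altitudeFoot i) -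
      (T.points k - T.altitudeFoot i) by abel, inner_sub_left, h1, h2]
  simp

lemma inner_outwardNormal_sub_point (T : Tet) {i j : Fin 4} (hj : j ≠ i) :
    inner ℝ (outwardNormal T i) (T.points i - T.points j) = - T.height i := by
  have h := T.inner_vsub_vsub_altitudeFoot_eq_height_sq hj.symm
  simp only [vsub_eq_sub] at h
  rw [outwardNormal, real_inner_smul_left, ← neg_sub (T.points i), inner_neg_left,
    real_inner_comm, h]
  have := T.height_pos i
  field_simp

lemma norm_outwardNormal (T : Tet) (i : Fin 4) : ‖outwardNormal T i‖ = 1 := by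
  have h := T.height_pos i
  rw [outwardNormal, norm_smul, norm_inv, Real.norm_of_nonneg h.le, ← dist_eq_norm, dist_comm]
  exact inv_mul_cancel₀ h.ne'

lemma inner_outwardNormal (T : Tet) (i : Fin 4) (y : E3) :
    inner ℝ (outwardNormal T i) y = - (T.height i * baryDeriv T i y) := by
  obtain ⟨k, hk⟩ := exists_ne i
  conv_lhs => rw [← sum_baryDeriv_smul_sub T (T.points k) y]
  rw [inner_sum, Finset.sum_eq_single i]
  · rw [real_inner_smul_right, inner_outwardNormal_sub_point T hk]; ring
  · intro j _ hj
    rw [real_inner_smul_right, inner_outwardNormal_point_sub T hj hk, mul_zero]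
  · simp

lemma baryDeriv_eq (T : Tet) (i : Fin 4) (y : E3) :
    baryDeriv T i y = - (inner ℝ (outwardNormal T i) y / T.height i) := by
  have h := T.height_pos i
  rw [inner_outwardNormal]
  field_simp

end Barycentric

/-! ### Incenter, contact points and shape regularity. -/

section Shape

lemma bary_incenter (T : Tet) (i : Fin 4) : bary T i T.incenter = T.inradius / T.height i := by
  rw [T.incenter_eq_affineCombination, bary_affineCombination _ _ _
    (T.sum_excenterWeights_eq_one_iff.2 T.excenterExists_empty), T.inradius_eq_abs_inv_sum,
    abs_of_pos (inv_pos.2 T.sum_excenterWeightsUnnorm_empty_pos)]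
  simp [Affine.Simplex.excenterWeights, div_eq_mul_inv]

lemma bary_incenter_pos (T : Tet) (i : Fin 4) : 0 < bary T i T.incenter := by
  rw [bary_incenter]
  exact div_pos T.inradius_pos (T.height_pos i)

lemma incenter_mem (T : Tet) : T.incenter ∈ T.closedInterior :=
  (mem_closedInterior_iff T _).2 fun i => (bary_incenter_pos T i).le

lemma bary_le_one (T : Tet) {x : E3} (hx : x ∈ T.closedInterior) (i : Fin 4) :
    bary T i x ≤ 1 := by
  rw [← sum_bary T x]
  exact Finset.single_le_sum (fun j _ => (mem_closedInterior_iff T x).1 hx j) (Finset.mem_univ i)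

lemma inradius_le_height (T : Tet) (i : Fin 4) : T.inradius ≤ T.height i := by
  have h := bary_le_one T (incenter_mem T) i
  rwa [bary_incenter, div_le_one (T.height_pos i)] at h

lemma dist_le_hT (T : Tet) {x y : E3} (hx : x ∈ T.closedInterior) (hy : y ∈ T.closedInterior) :
    dist x y ≤ hT T :=
  Metric.dist_le_diam_of_mem T.isCompact_closedInterior.isBounded hx hy

lemma norm_sub_le_hT (T : Tet) {x y : E3} (hx : x ∈ T.closedInterior)
    (hy : y ∈ T.closedInterior) : ‖x - y‖ ≤ hT T := by
  rw [← dist_eq_norm]; exact dist_le_hT T hx hy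

lemma height_le_hT (T : Tet) (i : Fin 4) : T.height i ≤ hT T := by
  obtain ⟨j, hj⟩ := exists_ne i
  have h := inner_outwardNormal_sub_point T hj
  have h2 := abs_real_inner_le_norm (outwardNormal T i) (T.points i - T.points j)
  rw [h, norm_outwardNormal, one_mul, abs_neg, abs_of_pos (T.height_pos i)] at h2
  exact h2.trans (norm_sub_le_hT T (T.point_mem_closedInterior i) (T.point_mem_closedInterior j))

lemma hT_pos (T : Tet) : 0 < hT T := (T.height_pos 0).trans_le (height_le_hT T 0)

lemma abs_baryDeriv_le (T : Tet) (i : Fin 4) (y : E3) :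
    |baryDeriv T i y| ≤ ‖y‖ / T.inradius := by
  rw [baryDeriv_eq, abs_neg, abs_div, abs_of_pos (T.height_pos i)]
  have h2 := abs_real_inner_le_norm (outwardNormal T i) y
  rw [norm_outwardNormal, one_mul] at h2
  exact div_le_div₀ (norm_nonneg _) h2 T.inradius_pos (inradius_le_height T i)

/-- The point at which the inscribed ball touches the face opposite to the vertex `i`. -/
noncomputable def contact (T : Tet) (i : Fin 4) : E3 :=
  T.incenter + T.inradius • outwardNormal T i

lemma bary_contact_self (T : Tet) (i : Fin 4) : bary T i (contact T i) = 0 := by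
  have h := T.height_pos i
  rw [contact, bary_add, bary_incenter, map_smul, baryDeriv_eq, real_inner_self_eq_norm_sq,
    norm_outwardNormal, smul_eq_mul]
  ring

/-- Moving from the incenter by r n_i lowers λ_j by (r / h_j) n_i · n_j, and 1 - n_i · n_j = |n_i -
n_j|² / 2 for unit vectors. A lower bound therefore only requires the normals to be separated. -/
lemma bary_contact (T : Tet) (i j : Fin 4) :
    bary T j (contact T i) = T.inradius / T.height j *
      (‖outwardNormal T i - outwardNormal T j‖ ^ 2 / 2) := by
  rw [contact, bary_add, bary_incenter, map_smul, baryDeriv_eq, norm_sub_sq_real,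
    norm_outwardNormal, norm_outwardNormal, smul_eq_mul, real_inner_comm]
  ring

/-- Test n_i - n_j against the edge from a third vertex k to vertex j. This edge lies in face i, so
n_i contributes nothing, while n_j sees the full height of vertex j. -/
lemma height_le_norm_sub_mul (T : Tet) {i j : Fin 4} (hij : i ≠ j) :
    T.height j ≤ ‖outwardNormal T i - outwardNormal T j‖ * hT T := by
  obtain ⟨k, hk⟩ : ∃ k : Fin 4, k ≠ i ∧ k ≠ j := by decide +revert
  have h1 := inner_outwardNormal_sub_point T hk.2
  have h2 := inner_outwardNormal_point_sub T hij.symm hk.1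
  have h3 := real_inner_le_norm (outwardNormal T i - outwardNormal T j)
    (T.points j - T.points k)
  rw [inner_sub_left, h1, h2, sub_neg_eq_add, zero_add] at h3
  exact h3.trans (mul_le_mul_of_nonneg_left
    (norm_sub_le_hT T (T.point_mem_closedInterior j) (T.point_mem_closedInterior k))
    (norm_nonneg _))

variable {σ : ℝ}

lemma sigma_pos {T : Tet} (hσ : hT T ≤ σ * (2 * T.inradius)) : 0 < σ := by
  have h := (hT_pos T).trans_le hσ
  exact pos_of_mul_pos_left h (by have := T.inradius_pos; positivity)

lemma le_inradius_div_height {T : Tet} (hσ : hT T ≤ σ * (2 * T.inradius)) (i : Fin 4) :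
    1 / (2 * σ) ≤ T.inradius / T.height i := by
  have h0 := sigma_pos hσ
  rw [div_le_div_iff₀ (by positivity) (T.height_pos i)]
  linarith [height_le_hT T i]

/-- One factor 1/(2σ) comes from r / h_j and two from |n_i - n_j| ≥ h_j / h_T ≥ r / h_T; the
remaining 1/2 is the one in `bary_contact`. -/
lemma le_bary_contact {T : Tet} (hσ : hT T ≤ σ * (2 * T.inradius)) {i j : Fin 4} (hij : i ≠ j) :
    1 / (16 * σ ^ 3) ≤ bary T j (contact T i) := by
  have h0 := sigma_pos hσ
  have h1 := le_inradius_div_height hσ j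
  have h2 : 1 / (2 * σ) ≤ ‖outwardNormal T i - outwardNormal T j‖ := by
    rw [div_le_iff₀ (by positivity)]
    have h3 := height_le_norm_sub_mul T hij
    have h4 := inradius_le_height T j
    have h5 := hT_pos T
    by_contra! hlt
    nlinarith [norm_nonneg (outwardNormal T i - outwardNormal T j)]
  rw [bary_contact]
  have h3 : 0 ≤ T.inradius / T.height j := le_trans (by positivity) h1
  calc 1 / (16 * σ ^ 3) = 1 / (2 * σ) * ((1 / (2 * σ)) ^ 2 / 2) := by field_simp; norm_num
    _ ≤ _ := by gcongr

end Shape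

/-! ### Two tetrahedra with a common face. -/

section Neighbor

lemma bary_eq_sum (S T : Tet) (i : Fin 4) (x : E3) :
    bary T i x = ∑ k, bary S k x * bary T i (S.points k) := by
  conv_lhs => rw [← affineCombination_bary S x]
  rw [Finset.map_affineCombination _ _ _ (sum_bary S x),
    Finset.univ.affineCombination_eq_linear_combination _ _ (sum_bary S x)]
  rfl

/-- Two tetrahedra with the same labelled vertices except for the vertex `i`. -/
def ShareFace (S T : Tet) (i : Fin 4) : Prop := ∀ j, j ≠ i → S.points j = T.points j

lemma ShareFace.symm {S T : Tet} {i : Fin 4} (h : ShareFace S T i) : ShareFace T S i :=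
  fun j hj => (h j hj).symm

lemma ShareFace.bary_self {S T : Tet} {i : Fin 4} (h : ShareFace S T i) (x : E3) :
    bary T i x = bary S i x * bary T i (S.points i) := by
  rw [bary_eq_sum S T, Finset.sum_eq_single i]
  · intro j _ hj
    rw [h j hj, bary_point, if_neg hj.symm, mul_zero]
  · simp

lemma ShareFace.bary_ne {S T : Tet} {i j : Fin 4} (h : ShareFace S T i) (hj : j ≠ i) (x : E3) :
    bary T j x = bary S j x + bary S i x * bary T j (S.points i) := by
  rw [bary_eq_sum S T, ← Finset.add_sum_erase _ _ (Finset.mem_univ i), add_comm,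
    Finset.sum_eq_single_of_mem j (by simp [hj])]
  · rw [h j hj, bary_point, if_pos rfl, mul_one]
  · intro k hk hkj
    rw [h k (Finset.ne_of_mem_erase hk), bary_point, if_neg hkj.symm, mul_zero]

lemma ShareFace.bary_mul_bary {S T : Tet} {i : Fin 4} (h : ShareFace S T i) :
    bary S i (T.points i) * bary T i (S.points i) = 1 := by
  rw [← h.bary_self, bary_point, if_pos rfl]

/-- Neighbours share vertices as sets, with unrelated labels. Incenter, inradius and diameter do not
depend on the labels, so the neighbour may be relabelled to compare coordinates index by index. -/
lemma exists_shareFace_reindex {S T : Tet} {i : Fin 4}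
    (h : ∀ j, j ≠ i → T.points j ∈ Set.range S.points) :
    ∃ e : Fin 4 ≃ Fin 4, ShareFace (S.reindex e) T i := by
  have h' : ∀ j : {j : Fin 4 // j ≠ i}, ∃ k, S.points k = T.points j := fun j => h j j.2
  choose f hf using h'
  have hinj : Function.Injective f := fun a b hab => by
    have : T.points a = T.points b := by rw [← hf, ← hf, hab]
    exact Subtype.ext (T.independent.injective this)
  let e : {j : Fin 4 // j ≠ i} ≃ {k : Fin 4 // k ∈ Set.range f} := Equiv.ofInjective f hinj
  refine ⟨(e.extendSubtype).symm, fun j hj => ?_⟩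
  rw [Affine.Simplex.reindex_points, Function.comp_apply, Equiv.symm_symm,
    Equiv.extendSubtype_apply_of_mem e j hj]
  exact hf ⟨j, hj⟩

/-- Conformity puts the vertex of the neighbour on the other side of the common face. -/
lemma bary_neg_of_conforming {S T : Tet} {i : Fin 4} (h : ShareFace S T i)
    (hne : Set.range S.points ≠ Set.range T.points)
    (hST : S.closedInterior ∩ T.closedInterior =
      convexHull ℝ (Set.range S.points ∩ Set.range T.points)) :
    bary T i (S.points i) < 0 := by
  by_contra! ha
  have hb : 0 < bary S i (T.points i) := by
    have h1 := h.bary_mul_bary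
    by_contra! hb
    nlinarith
  -- Common vertices lie in the plane of the face: if vertex i of `S` were a vertex of `T`, it could
  -- only be vertex i, and the two vertex sets would coincide.
  have hcommon : convexHull ℝ (Set.range S.points ∩ Set.range T.points) ⊆
      bary T i ⁻¹' {0} := by
    refine convexHull_min ?_ ((convex_singleton (0 : ℝ)).affine_preimage (bary T i))
    rintro _ ⟨⟨k, rfl⟩, l, hl⟩
    have hk : k ≠ i := by
      rintro rfl
      apply hne
      have hlk : l = k := by
        by_contra hlk
        rw [← h l hlk] at hl
        exact hlk (S.independent.injective hl)
      subst hlk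
      congr 1
      funext j
      by_cases hj : j = l
      · rw [hj, hl]
      · exact h j hj
    rw [Set.mem_preimage, h k hk, bary_point, if_neg hk.symm, Set.mem_singleton_iff]
  obtain ⟨L, hL0, hL⟩ : ∃ L : ℝ, 0 < L ∧ ∀ j, -bary S j (T.points i) ≤ L := by
    obtain ⟨L, hL⟩ := Finite.exists_le fun j => -bary S j (T.points i)
    exact ⟨max L 1, by positivity, fun j => (hL j).trans (le_max_left _ _)⟩
  -- This choice gives (1 - δ) / 3 = δ L. The point `y` with `T`-coordinates δ at i and δ L
  -- elsewhere then has `S`-coordinates at least δ L - δ L = 0 for j ≠ i. It lies in both tetrahedra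
  -- but off the plane of the face.
  obtain ⟨δ, hδ0, hδ1⟩ : ∃ δ : ℝ, 0 < δ ∧ δ * (3 * L + 1) = 1 :=
    ⟨1 / (3 * L + 1), by positivity, by field_simp⟩
  obtain ⟨w, hwi, hwj, hw⟩ : ∃ w : Fin 4 → ℝ, w i = δ ∧ (∀ j, j ≠ i → w j = (1 - δ) / 3) ∧
      ∑ j, w j = 1 := by
    refine ⟨fun j => if j = i then δ else (1 - δ) / 3, by simp, fun j hj => by simp [hj], ?_⟩
    rw [← Finset.add_sum_erase _ _ (Finset.mem_univ i), Finset.sum_congr rfl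
      (fun j hj => if_neg (Finset.ne_of_mem_erase hj)), Finset.sum_const,
      Finset.card_erase_of_mem (Finset.mem_univ i)]
    simp
    ring
  have hwT := fun j => bary_sum T j w hw
  set y : E3 := ∑ j, w j • T.points j
  have hyi : bary T i y = δ := by rw [hwT, hwi]
  have hyT : y ∈ T.closedInterior := by
    rw [mem_closedInterior_iff]
    intro j
    rw [hwT]
    by_cases hj : j = i
    · rw [hj, hwi]; exact hδ0.le
    · rw [hwj j hj]; nlinarith
  have hyS : y ∈ S.closedInterior := by
    rw [mem_closedInterior_iff]
    intro j
    by_cases hj : j = i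
    · rw [hj, h.symm.bary_self, hyi]; positivity
    · rw [h.symm.bary_ne hj, hyi, hwT, hwj j hj]
      nlinarith [hL j]
  have : y ∈ bary T i ⁻¹' {0} := hcommon (hST ▸ ⟨hyS, hyT⟩)
  rw [Set.mem_preimage, hyi, Set.mem_singleton_iff] at this
  exact hδ0.ne' this

lemma hT_reindex (T : Tet) (e : Fin 4 ≃ Fin 4) : hT (T.reindex e) = hT T := by
  rw [hT, hT, Affine.Simplex.closedInterior_reindex]

lemma bary_lineMap (T : Tet) (i : Fin 4) (x y : E3) (θ : ℝ) :
    bary T i (AffineMap.lineMap x y θ) = (1 - θ) * bary T i x + θ * bary T i y := by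
  rw [AffineMap.apply_lineMap, AffineMap.lineMap_apply_ring]

/-- A point on the segment joining the incenters which lies in the plane of the common face divides
the segment joining the contact points in the same ratio. -/
lemma ShareFace.lineMap_incenter_eq {S T : Tet} {i : Fin 4} (h : ShareFace S T i) {θ : ℝ}
    (hθ : bary T i (AffineMap.lineMap T.incenter S.incenter θ) = 0) :
    AffineMap.lineMap T.incenter S.incenter θ =
      (AffineMap.lineMap (contact T i) (contact S i) θ : E3) := by
  set m : E3 := AffineMap.lineMap T.incenter S.incenter θ
  set c : E3 := AffineMap.lineMap (contact T i) (contact S i) θ with hc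
  have hcT : bary T i c = 0 := by
    rw [hc, bary_lineMap, bary_contact_self, h.bary_self (contact S i), bary_contact_self]
    simp
  have hT0 : inner ℝ (outwardNormal T i) (m - c) = 0 := by
    rw [inner_outwardNormal, ← bary_sub, hθ, hcT]; simp
  have hS0 : inner ℝ (outwardNormal S i) (m - c) = 0 := by
    rw [inner_outwardNormal, ← bary_sub, h.symm.bary_self, h.symm.bary_self c, hθ, hcT]; simp
  -- The difference is orthogonal to both normals, since both points lie in the common plane, and it
  -- is also a combination of these normals; hence it vanishes.
  have hd : m - c = -((1 - θ) * T.inradius) • outwardNormal T i +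
      -(θ * S.inradius) • outwardNormal S i := by
    simp only [m, c, AffineMap.lineMap_apply_module, contact]
    module
  have : inner ℝ (m - c) (m - c) = 0 := by
    conv_lhs => enter [2]; rw [hd]
    rw [inner_add_left, real_inner_smul_left, real_inner_smul_left, hT0, hS0]
    simp
  exact sub_eq_zero.1 (inner_self_eq_zero.1 this)

end Neighbor

/-! ### Existence of split points and their distance from the edges. -/

section SplitPoint

variable {σ : ℝ}

/-- Three coordinates of a contact point sum to 1 and each is at least the bound. This lets the
barycenter of a boundary face satisfy the same bound as the other split points. -/
lemma kappa_le {T : Tet} (hσ : hT T ≤ σ * (2 * T.inradius)) : 1 / (16 * σ ^ 3) ≤ 1 / 3 := by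
  have h := sum_bary T (contact T 0)
  rw [Fin.sum_univ_four, bary_contact_self] at h
  have h1 := le_bary_contact hσ (i := 0) (j := 1) (by decide)
  have h2 := le_bary_contact hσ (i := 0) (j := 2) (by decide)
  have h3 := le_bary_contact hσ (i := 0) (j := 3) (by decide)
  linarith

lemma bary_faceOppositeCentroid (T : Tet) (i j : Fin 4) :
    bary T j (T.faceOppositeCentroid i) = if j = i then 0 else 1 / 3 := by
  have hw : ∑ k ∈ ({i}ᶜ : Finset (Fin 4)), ((3 : ℕ) : ℝ)⁻¹ = 1 := by
    simp [Finset.card_compl]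
  rw [T.faceOppositeCentroid_eq_affineCombination]
  split_ifs with h
  · exact T.basis.coord_apply_combination_of_notMem (by simp [h]) hw
  · exact (T.basis.coord_apply_combination_of_mem (by simp [h]) hw).trans (by norm_num)

/-- Every face has a split point, and it stays away from the edges of the face. -/
theorem exists_isFaceSplitPoint (M : TetMesh) (hM : M.ShapeRegular σ) {T : Tet} (hTM : T ∈ M.tets)
    (i : Fin 4) : ∃ p, M.IsFaceSplitPoint T i p ∧ bary T i p = 0 ∧
      ∀ j, j ≠ i → 1 / (16 * σ ^ 3) ≤ bary T j p := by
  have hσT := hM T hTM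
  have hσ0 := sigma_pos hσT
  by_cases hN : ∃ S, M.IsNeighbor T i S
  swap
  · refine ⟨T.faceOppositeCentroid i, Or.inr ⟨hN, rfl⟩, ?_, fun j hj => ?_⟩
    · rw [bary_faceOppositeCentroid, if_pos rfl]
    · rw [bary_faceOppositeCentroid, if_neg hj]
      exact kappa_le hσT
  obtain ⟨S, hS⟩ := hN
  obtain ⟨hSM, hne, hpts⟩ := id hS
  obtain ⟨e, he⟩ := exists_shareFace_reindex hpts
  have hneg : bary T i ((S.reindex e).points i) < 0 := by
    apply bary_neg_of_conforming he
    · rw [Affine.Simplex.reindex_range_points]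
      exact M.vertices_ne S hSM T hTM hne
    · rw [Affine.Simplex.reindex_range_points, Affine.Simplex.closedInterior_reindex]
      exact M.conforming S hSM T hTM hne
  have hσS : hT (S.reindex e) ≤ σ * (2 * (S.reindex e).inradius) := by
    rw [hT_reindex, Affine.Simplex.inradius_reindex]
    exact hM S hSM
  have hI : (S.reindex e).incenter = S.incenter := S.incenter_reindex e
  generalize S.reindex e = S' at *
  have hα := bary_incenter_pos T i
  have hβ : bary T i S'.incenter < 0 := by
    rw [he.bary_self]
    exact mul_neg_of_pos_of_neg (bary_incenter_pos S' i) hneg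
  set α := bary T i T.incenter with hαd
  set β := bary T i S'.incenter with hβd
  -- The parameter is the zero of (1 - θ) α + θ β, and it lies in [0, 1] because β < 0 < α.
  have hθ0 : 0 ≤ α / (α - β) := div_nonneg hα.le (by linarith)
  have hθ1 : α / (α - β) ≤ 1 := (div_le_one (by linarith)).2 (by linarith)
  set θ := α / (α - β) with hθ
  have hm : bary T i (AffineMap.lineMap T.incenter S'.incenter θ) = 0 := by
    rw [bary_lineMap, ← hαd, ← hβd, hθ]
    have : α - β ≠ 0 := by linarith
    field_simp
    ring
  have hk : ∀ j, j ≠ i →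
      1 / (16 * σ ^ 3) ≤ bary T j (AffineMap.lineMap T.incenter S'.incenter θ) := by
    intro j hj
    -- A convex combination of two contact points inherits their lower bound; in the common plane
    -- the coordinates of the two tetrahedra agree.
    rw [he.lineMap_incenter_eq hm, bary_lineMap]
    have h1 := le_bary_contact hσT hj.symm
    have h2 := le_bary_contact hσS hj.symm
    have h3 : bary T j (contact S' i) = bary S' j (contact S' i) := by
      rw [he.bary_ne hj, bary_contact_self, zero_mul, add_zero]
    rw [h3]
    nlinarith
  refine ⟨_, Or.inl ⟨S, hS, ?_, ?_⟩, hm, hk⟩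
  · rw [← hI]
    exact lineMap_mem_segment ℝ _ _ ⟨hθ0, hθ1⟩
  · rw [mem_face_iff]
    refine ⟨fun j => ?_, hm⟩
    by_cases hj : j = i
    · rw [hj, hm]
    · exact le_trans (by positivity) (hk j hj)

end SplitPoint

/-! ### Barycentric coordinates of the twelve subtetrahedra. -/

section SubTetrahedron

/-- The affine function which is `1` at the incenter of `T` and vanishes on the face opposite to
the vertex `i`. -/
noncomputable def tipCoord (T : Tet) (i : Fin 4) : E3 →ᵃ[ℝ] ℝ :=
  (bary T i T.incenter)⁻¹ • bary T i

/-- The barycentric coordinate belonging to the split point `p` in the tetrahedron spanned by the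
incenter of `T`, the split point `p` of the face opposite to the vertex `i`, and the edge of this
face opposite to the vertex `j`. -/
noncomputable def midCoord (T : Tet) (p : E3) (i j : Fin 4) : E3 →ᵃ[ℝ] ℝ :=
  (bary T j p)⁻¹ • (bary T j - bary T j T.incenter • tipCoord T i)

/-- The barycentric coordinate belonging to the vertex `k` of `T` in the tetrahedron described in
`midCoord`. -/
noncomputable def edgeCoord (T : Tet) (p : E3) (i j k : Fin 4) : E3 →ᵃ[ℝ] ℝ :=
  bary T k - bary T k T.incenter • tipCoord T i - bary T k p • midCoord T p i j

/-- The vertices of a tetrahedron of the local Worsey–Farin split. -/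
noncomputable def subPoint (T : Tet) (p : E3) (i j k : Fin 4) : E3 :=
  if k = i then T.incenter else if k = j then p else T.points k

/-- The barycentric coordinates of a tetrahedron of the local Worsey–Farin split. -/
noncomputable def subCoord (T : Tet) (p : E3) (i j k : Fin 4) : E3 →ᵃ[ℝ] ℝ :=
  if k = i then tipCoord T i else if k = j then midCoord T p i j else edgeCoord T p i j k

/-- A tetrahedron of the local Worsey–Farin split. -/
noncomputable def subTet (T : Tet) (p : E3) (i j : Fin 4) : Set E3 :=
  convexHull ℝ (Set.range (subPoint T p i j))

lemma tipCoord_apply (T : Tet) (i : Fin 4) (x : E3) :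
    tipCoord T i x = (bary T i T.incenter)⁻¹ * bary T i x := by
  simp [tipCoord]

lemma midCoord_apply (T : Tet) (p : E3) (i j : Fin 4) (x : E3) :
    midCoord T p i j x =
      (bary T j p)⁻¹ * (bary T j x - bary T j T.incenter * tipCoord T i x) := by
  simp [midCoord]

lemma edgeCoord_apply (T : Tet) (p : E3) (i j k : Fin 4) (x : E3) :
    edgeCoord T p i j k x = bary T k x - bary T k T.incenter * tipCoord T i x -
      bary T k p * midCoord T p i j x := by
  simp [edgeCoord]

lemma tipCoord_linear (T : Tet) (i : Fin 4) (y : E3) :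
    (tipCoord T i).linear y = (bary T i T.incenter)⁻¹ * baryDeriv T i y := by
  simp [tipCoord, baryDeriv]

lemma midCoord_linear (T : Tet) (p : E3) (i j : Fin 4) (y : E3) :
    (midCoord T p i j).linear y =
      (bary T j p)⁻¹ * (baryDeriv T j y - bary T j T.incenter * (tipCoord T i).linear y) := by
  simp [midCoord, baryDeriv]

lemma edgeCoord_linear (T : Tet) (p : E3) (i j k : Fin 4) (y : E3) :
    (edgeCoord T p i j k).linear y =
      baryDeriv T k y - bary T k T.incenter * (tipCoord T i).linear y -
        bary T k p * (midCoord T p i j).linear y := by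
  simp [edgeCoord, baryDeriv]

lemma convexHull_eq_subTet (T : Tet) (p : E3) {i j : Fin 4} (hij : j ≠ i) :
    convexHull ℝ (insert T.incenter (insert p (T.points '' {k | k ≠ i ∧ k ≠ j}))) =
      subTet T p i j := by
  rw [subTet]
  congr 1
  ext x
  simp only [Set.mem_insert_iff, Set.mem_image, Set.mem_range, Set.mem_ofPred_eq]
  constructor
  · rintro (rfl | rfl | ⟨k, ⟨hki, hkj⟩, rfl⟩)
    · exact ⟨i, by simp [subPoint]⟩
    · exact ⟨j, by simp [subPoint, hij]⟩
    · exact ⟨k, by simp [subPoint, hki, hkj]⟩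
  · rintro ⟨k, rfl⟩
    by_cases hki : k = i
    · left; simp [subPoint, hki]
    by_cases hkj : k = j
    · right; left; simp [subPoint, hkj, hij]
    · right; right; exact ⟨k, ⟨hki, hkj⟩, by simp [subPoint, hki, hkj]⟩

lemma sum_ite_ite {V : Type*} [AddCommGroup V] {i j : Fin 4} (hij : j ≠ i) (a b : V)
    (f : Fin 4 → V) (hi : f i = 0) (hj : f j = 0) :
    ∑ k, (if k = i then a else if k = j then b else f k) = a + b + ∑ k, f k := by
  have h : ∀ k, (if k = i then a else if k = j then b else f k) =
      (if k = i then a else 0) + (if k = j then b else 0) + f k := by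
    intro k
    by_cases hki : k = i
    · subst hki; simp [hi, hij.symm]
    by_cases hkj : k = j
    · subst hkj; simp [hj, hij]
    · simp [hki, hkj]
  simp only [h, Finset.sum_add_distrib, Finset.sum_ite_eq', Finset.mem_univ, if_true]

variable {T : Tet} {p : E3} {i j : Fin 4}

lemma edgeCoord_left (hp : bary T i p = 0) (x : E3) : edgeCoord T p i j i x = 0 := by
  rw [edgeCoord_apply, hp, tipCoord_apply, mul_inv_cancel_left₀ (bary_incenter_pos T i).ne']
  simp

lemma edgeCoord_right (hj : bary T j p ≠ 0) (x : E3) : edgeCoord T p i j j x = 0 := by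
  rw [edgeCoord_apply, midCoord_apply, mul_inv_cancel_left₀ hj, sub_self]

/-- The edge coordinates vanish for k = i and k = j, so the edge sum may run over all four vertices
of `T`. Expansions then need no case distinction on k. -/
lemma sum_subCoord_smul (hij : j ≠ i) (hp : bary T i p = 0) (hj : bary T j p ≠ 0) {V : Type*}
    [AddCommGroup V] [Module ℝ V] (f : Fin 4 → V) (a b : V) (x : E3) :
    ∑ k, subCoord T p i j k x • (if k = i then a else if k = j then b else f k) =
      tipCoord T i x • a + midCoord T p i j x • b + ∑ k, edgeCoord T p i j k x • f k := by
  rw [← sum_ite_ite hij _ _ _ (by rw [edgeCoord_left hp, zero_smul])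
    (by rw [edgeCoord_right hj, zero_smul])]
  refine Finset.sum_congr rfl fun k _ => ?_
  unfold subCoord
  split_ifs <;> rfl

lemma sum_subCoord (hij : j ≠ i) (hp : bary T i p = 0) (hj : bary T j p ≠ 0) (x : E3) :
    ∑ k, subCoord T p i j k x = 1 := by
  have h := sum_subCoord_smul hij hp hj (fun _ => (1 : ℝ)) 1 1 x
  simp only [ite_self, smul_eq_mul, mul_one] at h
  rw [h]
  simp only [edgeCoord_apply, Finset.sum_sub_distrib, ← Finset.sum_mul, sum_bary]
  ring

lemma sum_subCoord_smul_subPoint (hij : j ≠ i) (hp : bary T i p = 0) (hj : bary T j p ≠ 0)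
    (x : E3) : ∑ k, subCoord T p i j k x • subPoint T p i j k = x := by
  simp only [subPoint]
  rw [sum_subCoord_smul hij hp hj]
  simp only [edgeCoord_apply, sub_smul, Finset.sum_sub_distrib, sum_bary_smul, mul_smul]
  have h1 : ∑ k, bary T k T.incenter • tipCoord T i x • T.points k =
      tipCoord T i x • T.incenter := by
    conv_rhs => rw [← sum_bary_smul T T.incenter]
    rw [Finset.smul_sum]
    exact Finset.sum_congr rfl fun k _ => smul_comm _ _ _
  have h2 : ∑ k, bary T k p • midCoord T p i j x • T.points k = midCoord T p i j x • p := by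
    generalize midCoord T p i j x = c
    conv_rhs => rw [← sum_bary_smul T p]
    rw [Finset.smul_sum]
    exact Finset.sum_congr rfl fun k _ => smul_comm _ _ _
  rw [h1, h2]
  abel

lemma subCoord_subPoint (hij : j ≠ i) (hp : bary T i p = 0) (hj : bary T j p ≠ 0)
    (k l : Fin 4) : subCoord T p i j k (subPoint T p i j l) = if k = l then 1 else 0 := by
  have hI := (bary_incenter_pos T i).ne'
  by_cases hli : l = i
  · subst hli
    have h1 : tipCoord T l T.incenter = 1 := by rw [tipCoord_apply, inv_mul_cancel₀ hI]
    have h2 : midCoord T p l j T.incenter = 0 := by rw [midCoord_apply, h1]; simp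
    rw [subPoint, if_pos rfl]
    unfold subCoord
    split_ifs with h h'
    · exact h1
    · exact h2
    · rw [edgeCoord_apply, h1, h2]; simp
  by_cases hlj : l = j
  · subst hlj
    have h1 : tipCoord T i p = 0 := by rw [tipCoord_apply, hp, mul_zero]
    have h2 : midCoord T p i l p = 1 := by
      rw [midCoord_apply, h1, mul_zero, sub_zero, inv_mul_cancel₀ hj]
    rw [subPoint, if_neg hli, if_pos rfl]
    unfold subCoord
    by_cases hki : k = i
    · rw [if_pos hki, h1, if_neg (by rw [hki]; exact Ne.symm hli)]
    · rw [if_neg hki]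
      split_ifs with h
      · exact h2
      · rw [edgeCoord_apply, h1, h2]; simp
  · have h1 : tipCoord T i (T.points l) = 0 := by
      rw [tipCoord_apply, bary_point, if_neg (Ne.symm hli), mul_zero]
    have h2 : midCoord T p i j (T.points l) = 0 := by
      rw [midCoord_apply, h1, bary_point, if_neg (Ne.symm hlj)]; simp
    rw [subPoint, if_neg hli, if_neg hlj]
    unfold subCoord
    by_cases hki : k = i
    · rw [if_pos hki, h1, if_neg (by rw [hki]; exact Ne.symm hli)]
    · rw [if_neg hki]
      by_cases hkj : k = j
      · rw [if_pos hkj, h2, if_neg (by rw [hkj]; exact Ne.symm hlj)]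
      · rw [if_neg hkj, edgeCoord_apply, h1, h2, bary_point]; simp

lemma mem_subTet (hij : j ≠ i) (hp : bary T i p = 0) (hj : bary T j p ≠ 0) {x : E3}
    (hx : ∀ k, 0 ≤ subCoord T p i j k x) : x ∈ subTet T p i j := by
  rw [← sum_subCoord_smul_subPoint hij hp hj x]
  exact (convex_convexHull ℝ _).sum_mem (fun k _ => hx k) (sum_subCoord hij hp hj x)
    fun k _ => subset_convexHull ℝ _ ⟨k, rfl⟩

lemma subPoint_mem (T : Tet) (p : E3) (i j k : Fin 4) : subPoint T p i j k ∈ subTet T p i j :=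
  subset_convexHull ℝ _ ⟨k, rfl⟩

lemma affine_eq_sum_subCoord (hij : j ≠ i) (hp : bary T i p = 0) (hj : bary T j p ≠ 0)
    (A : E3 →ᵃ[ℝ] E3) (x : E3) :
    A x = ∑ k, subCoord T p i j k x • A (subPoint T p i j k) := by
  have hs := sum_subCoord hij hp hj x
  conv_lhs => rw [← sum_subCoord_smul_subPoint hij hp hj x,
    ← Finset.univ.affineCombination_eq_linear_combination _ _ hs]
  rw [Finset.map_affineCombination _ _ _ hs,
    Finset.univ.affineCombination_eq_linear_combination _ _ hs]
  rfl

lemma affine_linear_eq_sum_subCoord (hij : j ≠ i) (hp : bary T i p = 0) (hj : bary T j p ≠ 0)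
    (A : E3 →ᵃ[ℝ] E3) (y : E3) :
    A.linear y = ∑ k, (subCoord T p i j k).linear y • A (subPoint T p i j k) := by
  have h : A.linear y = A (y +ᵥ (0 : E3)) - A 0 := by rw [AffineMap.map_vadd]; simp
  rw [h, affine_eq_sum_subCoord hij hp hj A (y +ᵥ (0 : E3)), affine_eq_sum_subCoord hij hp hj A 0,
    ← Finset.sum_sub_distrib]
  refine Finset.sum_congr rfl fun k _ => ?_
  rw [← sub_smul, AffineMap.map_vadd]
  simp

end SubTetrahedron

/-! ### Covering by the subtetrahedra and gradient bounds. -/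

section Quantitative

/-- `p i` lies in the face of `T` opposite to the vertex `i` and its barycentric coordinates
there are at least `κ`. -/
structure IsSplit (T : Tet) (κ : ℝ) (p : Fin 4 → E3) : Prop where
  pos : 0 < κ
  bary_self : ∀ i, bary T i (p i) = 0
  le_bary : ∀ i j, j ≠ i → κ ≤ bary T j (p i)

variable {T : Tet} {κ : ℝ} {p : Fin 4 → E3}

namespace IsSplit

lemma bary_pos (h : IsSplit T κ p) {i j : Fin 4} (hij : j ≠ i) : 0 < bary T j (p i) :=
  h.pos.trans_le (h.le_bary i j hij)

lemma mem_face (h : IsSplit T κ p) (i : Fin 4) : p i ∈ face T i := by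
  refine (mem_face_iff T i _).2 ⟨fun j => ?_, h.bary_self i⟩
  by_cases hj : j = i
  · rw [hj, h.bary_self]
  · exact (h.bary_pos hj).le

lemma mem (h : IsSplit T κ p) (i : Fin 4) : p i ∈ T.closedInterior :=
  face_subset T i (h.mem_face i)

lemma le_one (h : IsSplit T κ p) : κ ≤ 1 :=
  (h.le_bary 0 1 (by decide)).trans (bary_le_one T (h.mem 0) 1)

lemma subTet_subset (h : IsSplit T κ p) (i j : Fin 4) :
    subTet T (p i) i j ⊆ T.closedInterior := by
  rw [← Affine.Simplex.convexHull_eq_closedInterior]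
  refine convexHull_min ?_ (convex_convexHull ℝ _)
  rintro _ ⟨k, rfl⟩
  rw [Affine.Simplex.convexHull_eq_closedInterior]
  unfold subPoint
  split_ifs
  · exact incenter_mem T
  · exact h.mem i
  · exact T.point_mem_closedInterior k

/-- After the incenter's share of x is removed, nonnegative coordinates supported on face i remain.
The smallest ratio to the coordinates of `p i` is the largest multiple of `p i` that can still be
subtracted, and the index j attaining it names the edge. -/
lemma exists_edge (h : IsSplit T κ p) {i : Fin 4} {x : E3}
    (hx : ∀ k, 0 ≤ bary T k x - bary T k T.incenter * tipCoord T i x)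
    (ht : 0 ≤ tipCoord T i x) : ∃ j, j ≠ i ∧ ∀ k, 0 ≤ subCoord T (p i) i j k x := by
  obtain ⟨j, hj, hmin⟩ := Finset.exists_min_image (Finset.univ.erase i)
    (fun j => (bary T j x - bary T j T.incenter * tipCoord T i x) / bary T j (p i))
    (by obtain ⟨k, hk⟩ := exists_ne i; exact ⟨k, by simp [hk]⟩)
  have hji : j ≠ i := Finset.ne_of_mem_erase hj
  have hm : midCoord T (p i) i j x =
      (bary T j x - bary T j T.incenter * tipCoord T i x) / bary T j (p i) := by
    rw [midCoord_apply, div_eq_inv_mul]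
  refine ⟨j, hji, fun k => ?_⟩
  unfold subCoord
  by_cases hki : k = i
  · rwa [if_pos hki]
  rw [if_neg hki]
  split_ifs
  · rw [hm]
    exact div_nonneg (hx j) (h.bary_pos hji).le
  · have := hmin k (by simp [hki])
    rw [← hm, le_div_iff₀ (h.bary_pos hki)] at this
    rw [edgeCoord_apply]
    linarith

/-- The face is the one minimising λ_i(x) / λ_i(I): this minimum is the largest multiple of the
incenter that can be subtracted with all coordinates staying nonnegative. -/
lemma exists_subCoord_nonneg (h : IsSplit T κ p) {x : E3} (hx : x ∈ T.closedInterior) :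
    ∃ i j, j ≠ i ∧ ∀ k, 0 ≤ subCoord T (p i) i j k x := by
  obtain ⟨i, -, hmin⟩ := Finset.exists_min_image Finset.univ (fun i => tipCoord T i x)
    Finset.univ_nonempty
  have hx' := (mem_closedInterior_iff T x).1 hx
  refine ⟨i, h.exists_edge (fun k => ?_) ?_⟩
  · have := hmin k (Finset.mem_univ k)
    have hk := bary_incenter_pos T k
    have h2 : bary T k T.incenter * tipCoord T k x = bary T k x := by
      rw [tipCoord_apply, mul_inv_cancel_left₀ hk.ne']
    nlinarith
  · rw [tipCoord_apply]
    exact mul_nonneg (inv_nonneg.2 (bary_incenter_pos T i).le) (hx' i)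

lemma exists_subCoord_nonneg_of_mem_face (h : IsSplit T κ p) {i : Fin 4} {x : E3}
    (hx : x ∈ face T i) : ∃ j, j ≠ i ∧ ∀ k, 0 ≤ subCoord T (p i) i j k x := by
  obtain ⟨h1, h2⟩ := (mem_face_iff T i x).1 hx
  have ht : tipCoord T i x = 0 := by rw [tipCoord_apply, h2, mul_zero]
  exact h.exists_edge (fun k => by rw [ht, mul_zero, sub_zero]; exact h1 k) ht.ge

end IsSplit

/-- The incenter is at distance r from every face, so the slope is 1/r for each i and the heights
cancel. This ties the normal components to the divergence terms. -/
lemma tipCoord_linear_eq (T : Tet) (i : Fin 4) (y : E3) :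
    (tipCoord T i).linear y = - (inner ℝ (outwardNormal T i) y / T.inradius) := by
  have h1 := T.inradius_pos
  have h2 := T.height_pos i
  rw [tipCoord_linear, bary_incenter, baryDeriv_eq]
  field_simp

lemma abs_inner_outwardNormal_le (T : Tet) (i : Fin 4) (y : E3) :
    |inner ℝ (outwardNormal T i) y| ≤ ‖y‖ := by
  simpa [norm_outwardNormal] using abs_real_inner_le_norm (outwardNormal T i) y

lemma abs_tipCoord_linear_le (T : Tet) (i : Fin 4) (y : E3) :
    |(tipCoord T i).linear y| ≤ ‖y‖ / T.inradius := by
  rw [tipCoord_linear_eq, abs_neg, abs_div, abs_of_pos T.inradius_pos]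
  have := T.inradius_pos
  gcongr
  exact abs_inner_outwardNormal_le T i y

lemma bary_incenter_le_one (T : Tet) (i : Fin 4) : bary T i T.incenter ≤ 1 :=
  bary_le_one T (incenter_mem T) i

lemma IsSplit.abs_midCoord_linear_le (h : IsSplit T κ p) {i j : Fin 4} (hij : j ≠ i) (y : E3) :
    |(midCoord T (p i) i j).linear y| ≤ 2 / κ * (‖y‖ / T.inradius) := by
  have h0 := h.pos
  rw [midCoord_linear, abs_mul, abs_of_pos (inv_pos.2 (h.bary_pos hij)), div_eq_inv_mul,
    mul_assoc]
  have h1 := abs_tipCoord_linear_le T i y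
  have h2 := abs_baryDeriv_le T j y
  have h3 : |bary T j T.incenter * (tipCoord T i).linear y| ≤ ‖y‖ / T.inradius := by
    rw [abs_mul, abs_of_pos (bary_incenter_pos T j)]
    have := bary_incenter_le_one T j
    nlinarith [abs_nonneg ((tipCoord T i).linear y)]
  have h4 := abs_sub (baryDeriv T j y) (bary T j T.incenter * (tipCoord T i).linear y)
  gcongr
  · exact h.le_bary i j hij
  · linarith

/-- The edge coordinates are the worst case: 1 + 1 + 2/κ ≤ 4/κ, in units of ‖y‖ / r, because κ ≤ 1.
-/
lemma IsSplit.abs_subCoord_linear_le (h : IsSplit T κ p) {i j : Fin 4} (hij : j ≠ i) (k : Fin 4)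
    (y : E3) : |(subCoord T (p i) i j k).linear y| ≤ 4 / (κ * T.inradius) * ‖y‖ := by
  have h0 := h.pos
  have hr := T.inradius_pos
  have hκ : 1 ≤ 1 / κ := (one_le_div h0).2 h.le_one
  set Y := ‖y‖ / T.inradius with hY
  have hY0 : 0 ≤ Y := by positivity
  have h1 := abs_tipCoord_linear_le T i y
  have h2 := h.abs_midCoord_linear_le hij y
  have h3 := abs_baryDeriv_le T k y
  rw [show 2 / κ = 2 * (1 / κ) by ring] at h2
  rw [show 4 / (κ * T.inradius) * ‖y‖ = 4 * (1 / κ) * Y by rw [hY]; field_simp]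
  have h5 : Y ≤ 1 / κ * Y := le_mul_of_one_le_left hY0 hκ
  unfold subCoord
  split_ifs with hki hkj
  · linarith
  · linarith
  · rw [edgeCoord_linear]
    have h6 : |bary T k T.incenter * (tipCoord T i).linear y| ≤ Y := by
      rw [abs_mul, abs_of_pos (bary_incenter_pos T k)]
      have := bary_incenter_le_one T k
      nlinarith [abs_nonneg ((tipCoord T i).linear y)]
    have h7 : |bary T k (p i) * (midCoord T (p i) i j).linear y| ≤ 2 * (1 / κ) * Y := by
      rw [abs_mul, abs_of_pos (h.bary_pos hki)]
      have := bary_le_one T (h.mem i) k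
      nlinarith [abs_nonneg ((midCoord T (p i) i j).linear y), h.bary_pos hki]
    have h8 := abs_sub (baryDeriv T k y) (bary T k T.incenter * (tipCoord T i).linear y)
    have h9 := abs_sub (baryDeriv T k y - bary T k T.incenter * (tipCoord T i).linear y)
      (bary T k (p i) * (midCoord T (p i) i j).linear y)
    linarith

/-- Every tetrahedron of the split contains a ball of comparable size. -/
lemma IsSplit.closedBall_subset (h : IsSplit T κ p) {i j : Fin 4} (hij : j ≠ i) :
    Metric.closedBall (∑ l, (1 / 4 : ℝ) • subPoint T (p i) i j l) (κ * T.inradius / 16) ⊆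
      subTet T (p i) i j := by
  have h0 := h.pos
  have hr := T.inradius_pos
  intro x hx
  have hp := h.bary_self i
  have hj := (h.bary_pos hij).ne'
  refine mem_subTet hij hp hj fun k => ?_
  set z := ∑ l, (1 / 4 : ℝ) • subPoint T (p i) i j l
  -- All coordinates are 1/4 at the centroid; with slope at most 4 / (κ r), the radius κ r / 16 uses
  -- up at most this 1/4.
  have hz : subCoord T (p i) i j k z = 1 / 4 := by
    have hs : ∑ l : Fin 4, (1 / 4 : ℝ) = 1 := by simp
    rw [show z = Finset.univ.affineCombination ℝ (subPoint T (p i) i j) (fun _ => 1 / 4) from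
      (Finset.univ.affineCombination_eq_linear_combination _ _ hs).symm,
      Finset.map_affineCombination _ _ _ hs,
      Finset.univ.affineCombination_eq_linear_combination _ _ hs]
    simp [subCoord_subPoint hij hp hj]
  have h1 := h.abs_subCoord_linear_le hij k (x - z)
  have h2 : subCoord T (p i) i j k x - subCoord T (p i) i j k z =
      (subCoord T (p i) i j k).linear (x - z) :=
    ((subCoord T (p i) i j k).linearMap_vsub x z).symm
  have h3 : 4 / (κ * T.inradius) * ‖x - z‖ ≤ 1 / 4 := by
    rw [Metric.mem_closedBall, dist_eq_norm] at hx
    calc _ ≤ 4 / (κ * T.inradius) * (κ * T.inradius / 16) := by gcongr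
      _ = 1 / 4 := by field_simp; norm_num
  have h4 := neg_abs_le ((subCoord T (p i) i j k).linear (x - z))
  linarith

end Quantitative

/-! ### Solving for the incenter and split point values. -/

section Inversion

variable {T : Tet} {κ : ℝ} {p : Fin 4 → E3}

lemma norm_le_of_abs_baryDeriv_le (T : Tet) (y : E3) {B : ℝ} (hB : ∀ k, |baryDeriv T k y| ≤ B) :
    ‖y‖ ≤ 4 * hT T * B := by
  conv_lhs => rw [← sum_baryDeriv_smul_sub T (T.points 0) y]
  refine (norm_sum_le _ _).trans ?_
  calc ∑ k, ‖baryDeriv T k y • (T.points k - T.points 0)‖ ≤ ∑ k : Fin 4, B * hT T := by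
        refine Finset.sum_le_sum fun k _ => ?_
        rw [norm_smul]
        exact mul_le_mul (hB k)
          (norm_sub_le_hT T (T.point_mem_closedInterior k) (T.point_mem_closedInterior 0))
          (norm_nonneg _) ((abs_nonneg _).trans (hB k))
    _ = 4 * hT T * B := by simp; ring

/-- Control of the values at the incenter and at the split points by the normal components at the
split points and the contributions of these values to the divergence. -/
lemma IsSplit.norm_le (h : IsSplit T κ p) (u : E3) (z : Fin 4 → E3) {R Q : ℝ}
    (hR : ∀ i j, j ≠ i → |(tipCoord T i).linear u + (midCoord T (p i) i j).linear (z i)| ≤ R)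
    (hQ : ∀ i, |inner ℝ (outwardNormal T i) (z i)| ≤ Q) :
    ‖u‖ ≤ 8 * hT T * (R + Q / T.inradius) ∧
      ∀ i, ‖z i‖ ≤ 8 * hT T * (R + Q / T.inradius) := by
  have hr := T.inradius_pos
  have hh := hT_pos T
  have hR0 : 0 ≤ R := (abs_nonneg _).trans (hR 0 1 (by decide))
  have hQ0 : 0 ≤ Q := (abs_nonneg _).trans (hQ 0)
  have htz : ∀ i, |(tipCoord T i).linear (z i)| ≤ Q / T.inradius := fun i => by
    rw [tipCoord_linear_eq, abs_neg, abs_div, abs_of_pos hr]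
    gcongr
    exact hQ i
  have hmul : ∀ i j, j ≠ i → bary T j (p i) *
      ((tipCoord T i).linear u + (midCoord T (p i) i j).linear (z i)) =
      bary T j (p i) * (tipCoord T i).linear u +
        (baryDeriv T j (z i) - bary T j T.incenter * (tipCoord T i).linear (z i)) := by
    intro i j hij
    rw [midCoord_linear, mul_add, mul_inv_cancel_left₀ (h.bary_pos hij).ne']
  have hself : ∀ i (y : E3), baryDeriv T i y = bary T i T.incenter * (tipCoord T i).linear y :=
    fun i y => by rw [tipCoord_linear, mul_inv_cancel_left₀ (bary_incenter_pos T i).ne']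
  have hsum : ∀ i, ∑ j ∈ Finset.univ.erase i, bary T j (p i) = 1 := fun i => by
    rw [Finset.sum_erase (f := fun j => bary T j (p i)) _ (h.bary_self i), sum_bary]
  have hu : ∀ i, |(tipCoord T i).linear u| ≤ R + Q / T.inradius := by
    intro i
    -- The weights sum to 1 and the dλ_j sum to zero, so the average over the three subtetrahedra of
    -- face i sees only the normal component of z_i.
    have h1 : ∑ j ∈ Finset.univ.erase i, bary T j (p i) *
        ((tipCoord T i).linear u + (midCoord T (p i) i j).linear (z i)) =
        (tipCoord T i).linear u - (tipCoord T i).linear (z i) := by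
      rw [Finset.sum_congr rfl fun j hj => hmul i j (Finset.ne_of_mem_erase hj),
        Finset.sum_add_distrib, ← Finset.sum_mul, hsum, Finset.sum_erase _ (by
          rw [hself]; ring), Finset.sum_sub_distrib, sum_baryDeriv, ← Finset.sum_mul, sum_bary]
      ring
    have h2 : |∑ j ∈ Finset.univ.erase i, bary T j (p i) *
        ((tipCoord T i).linear u + (midCoord T (p i) i j).linear (z i))| ≤ R := by
      refine (Finset.abs_sum_le_sum_abs _ _).trans ?_
      calc _ ≤ ∑ j ∈ Finset.univ.erase i, bary T j (p i) * R := by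
            refine Finset.sum_le_sum fun j hj => ?_
            have hij := Finset.ne_of_mem_erase hj
            rw [abs_mul, abs_of_pos (h.bary_pos hij)]
            exact mul_le_mul_of_nonneg_left (hR i j hij) (h.bary_pos hij).le
        _ = R := by rw [← Finset.sum_mul, hsum, one_mul]
    rw [h1] at h2
    have h3 := abs_sub_abs_le_abs_sub ((tipCoord T i).linear u) ((tipCoord T i).linear (z i))
    linarith [htz i]
  have hI := fun i => bary_incenter_pos T i
  have hI1 := fun i => bary_incenter_le_one T i
  have hB : 0 ≤ Q / T.inradius := by positivity
  constructor
  · refine (norm_le_of_abs_baryDeriv_le T u (B := R + Q / T.inradius) fun i => ?_).trans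
      (by nlinarith [mul_nonneg hh.le (add_nonneg hR0 hB)])
    rw [hself, abs_mul, abs_of_pos (hI i)]
    nlinarith [hu i, hI i, hI1 i, abs_nonneg ((tipCoord T i).linear u)]
  · intro i
    refine (norm_le_of_abs_baryDeriv_le T (z i) (B := 2 * (R + Q / T.inradius))
      fun j => ?_).trans (by nlinarith)
    have hmulle : ∀ a b c : ℝ, 0 < a → a ≤ 1 → |b| ≤ c → |a * b| ≤ c := by
      intro a b c ha ha1 hb
      rw [abs_mul, abs_of_pos ha]
      nlinarith [abs_nonneg b]
    by_cases hij : j = i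
    · rw [hself, hij]
      exact (hmulle _ _ _ (hI i) (hI1 i) (htz i)).trans (by linarith)
    -- With dt_i(u) and dt_i(z_i) known, a single divergence relation isolates dλ_j(z_i); the three
    -- bounds add up to R + (R + Q/r) + Q/r.
    · have e := hmul i j hij
      have b1 := abs_le.1 (hmulle _ _ _ (h.bary_pos hij) (bary_le_one T (h.mem i) j) (hR i j hij))
      have b2 := abs_le.1 (hmulle _ _ _ (h.bary_pos hij) (bary_le_one T (h.mem i) j) (hu i))
      have b3 := abs_le.1 (hmulle _ _ _ (hI j) (hI1 j) (htz i))
      rw [abs_le]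
      constructor <;> linarith [b1.1, b1.2, b2.1, b2.2, b3.1, b3.2]

end Inversion

/-! ### Surface measure on a face. -/

section FaceMeasure

lemma finrank_ker_baryDeriv (T : Tet) (i : Fin 4) :
    Module.finrank ℝ (LinearMap.ker (baryDeriv T i)) = 2 := by
  have h : baryDeriv T i ≠ 0 := by
    obtain ⟨j, hj⟩ := exists_ne i
    intro h0
    have := bary_sub T i (T.points i) (T.points j)
    rw [h0, bary_point, bary_point, if_pos rfl, if_neg hj.symm] at this
    simp at this
  have := Module.Dual.finrank_ker_add_one_of_ne_zero h
  rw [finrank_euclideanSpace_fin] at this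
  omega

/-- The disc of radius `δ` around `m` in the plane of the face opposite to the vertex `i`. -/
def faceDisc (T : Tet) (i : Fin 4) (m : E3) (δ : ℝ) : Set E3 :=
  {x | bary T i x = 0} ∩ Metric.closedBall m δ

/-- The plane of the face is an isometric copy of ℝ², on which `μHE[2]` is Lebesgue measure. Discs
suffice to bound the area of a face from above and that of a neighbourhood of the split point from
below. -/
lemma measure_faceDisc (T : Tet) (i : Fin 4) {m : E3} (hm : bary T i m = 0) {δ : ℝ}
    (hδ : 0 ≤ δ) : μHE[2] (faceDisc T i m δ) = ENNReal.ofReal (δ ^ 2 * Real.pi) := by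
  let W := LinearMap.ker (baryDeriv T i)
  have hW : Module.finrank ℝ W = 2 := finrank_ker_baryDeriv T i
  let L : W ≃ₗᵢ[ℝ] EuclideanSpace ℝ (Fin 2) :=
    ((stdOrthonormalBasis ℝ W).reindex (finCongr hW)).repr
  let φ : EuclideanSpace ℝ (Fin 2) → E3 := fun x => m + (L.symm x : E3)
  have hφ : Isometry φ := Isometry.of_dist_eq fun x y => by
    simp only [φ, dist_add_left]
    exact L.symm.isometry.dist_eq x y
  have himg : φ '' Metric.closedBall 0 δ = faceDisc T i m δ := by
    ext x
    constructor
    · rintro ⟨y, hy, rfl⟩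
      refine ⟨?_, ?_⟩
      · have : baryDeriv T i (L.symm y : E3) = 0 := (L.symm y).2
        simp [φ, bary_add, hm, this]
      · rw [Metric.mem_closedBall, dist_eq_norm] at hy ⊢
        have h1 : ‖(L.symm y : E3)‖ = ‖y‖ := L.symm.norm_map y
        simpa [φ, h1] using hy
    · rintro ⟨hx, hxm⟩
      have hk : x - m ∈ W := by
        change baryDeriv T i (x - m) = 0
        rw [← bary_sub, hm, sub_zero]
        exact hx
      refine ⟨L ⟨x - m, hk⟩, ?_, by simp [φ]⟩
      rw [Metric.mem_closedBall, dist_eq_norm] at hxm ⊢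
      simpa using hxm
  rw [← himg, hφ.euclideanHausdorffMeasure_image,
    EuclideanSpace.euclideanHausdorffMeasure_eq_volume, EuclideanSpace.volume_closedBall_fin_two,
    ENNReal.ofReal_mul (by positivity), ENNReal.ofReal_pow hδ]

lemma measure_real_faceDisc (T : Tet) (i : Fin 4) {m : E3} (hm : bary T i m = 0) {δ : ℝ}
    (hδ : 0 ≤ δ) : (μHE[2] : Measure E3).real (faceDisc T i m δ) = δ ^ 2 * Real.pi := by
  rw [measureReal_def, measure_faceDisc T i hm hδ, ENNReal.toReal_ofReal (by positivity)]

lemma isClosed_faceDisc (T : Tet) (i : Fin 4) (m : E3) (δ : ℝ) : IsClosed (faceDisc T i m δ) :=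
  (isClosed_eq (continuous_bary T i) continuous_const).inter Metric.isClosed_closedBall

lemma face_subset_faceDisc (T : Tet) {i : Fin 4} {m : E3} (hm : m ∈ T.closedInterior) :
    face T i ⊆ faceDisc T i m (hT T) := fun _ hx =>
  ⟨((mem_face_iff T i _).1 hx).2, dist_le_hT T (face_subset T i hx) hm⟩

lemma isCompact_face (T : Tet) (i : Fin 4) : IsCompact (face T i) :=
  (T.faceOpposite i).isCompact_closedInterior

/-- A function that is close to a nonnegative multiple of a constant `c` on a set `F`, the
multiple being at least `1 / 2` on a part `D` of `F`, controls `c` through its integral. -/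
lemma mul_measureReal_le_of_approx {α : Type*} [MeasurableSpace α] {μ : Measure α} {F D : Set α}
    (hF : MeasurableSet F) (hD : MeasurableSet D) (hDF : D ⊆ F) (hμ : μ F ≠ ⊤) {f : α → ℝ}
    (hf : IntegrableOn f F μ) {c a : ℝ}
    (h : ∀ x ∈ F, ∃ t : ℝ, 0 ≤ t ∧ (x ∈ D → 1 / 2 ≤ t) ∧ |f x - t * c| ≤ a) :
    |c| * (μ.real D / 2) ≤ |∫ x in F, f x ∂μ| + a * μ.real F := by
  wlog hc : 0 ≤ c generalizing f c
  · have := this (f := fun x => -f x) (c := -c) hf.neg (fun x hx => by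
      obtain ⟨t, h1, h2, h3⟩ := h x hx
      exact ⟨t, h1, h2, by rwa [mul_neg, ← neg_sub', abs_neg]⟩) (by linarith)
    rwa [abs_neg, integral_neg, abs_neg] at this
  rw [abs_of_nonneg hc]
  have hint : IntegrableOn (fun x => D.indicator (fun _ => c / 2) x - a) F μ := by
    refine Integrable.sub ?_ (integrableOn_const hμ)
    exact (integrableOn_const (C := c / 2) hμ).indicator hD
  -- Pointwise f ≥ (c / 2) 1_D - a: off D only t ≥ 0 is known, and c ≥ 0 makes that enough.
  have hle : ∫ x in F, (D.indicator (fun _ => c / 2) x - a) ∂μ ≤ ∫ x in F, f x ∂μ := by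
    refine setIntegral_mono_on hint hf hF fun x hx => ?_
    obtain ⟨t, h1, h2, h3⟩ := h x hx
    have h4 := (abs_le.1 h3).1
    by_cases hxD : x ∈ D
    · rw [Set.indicator_of_mem hxD]
      nlinarith [h2 hxD]
    · rw [Set.indicator_of_notMem hxD]
      nlinarith
  rw [integral_sub ((integrableOn_const (C := c / 2) hμ).indicator hD) (integrableOn_const hμ),
    setIntegral_indicator hD, Set.inter_eq_right.2 hDF, setIntegral_const, setIntegral_const,
    smul_eq_mul, smul_eq_mul] at hle
  linarith [le_abs_self (∫ x in F, f x ∂μ)]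

end FaceMeasure

/-! ### Nodal expansion and the flux estimate. -/

section PiecewiseAffine

/-- `v` is affine on each tetrahedron of the local split with split points `p`. -/
def IsPiecewiseAffine (T : Tet) (p : Fin 4 → E3) (v : E3 → E3) : Prop :=
  ∀ i j, j ≠ i → ∃ A : E3 →ᵃ[ℝ] E3, Set.EqOn v A (subTet T (p i) i j)

variable {T : Tet} {κ : ℝ} {p : Fin 4 → E3} {v : E3 → E3}

lemma IsSplit.edgeCoord_nonneg (h : IsSplit T κ p) {i j : Fin 4} (hij : j ≠ i) {x : E3}
    (hx : ∀ k, 0 ≤ subCoord T (p i) i j k x) (k : Fin 4) : 0 ≤ edgeCoord T (p i) i j k x := by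
  by_cases hki : k = i
  · rw [hki, edgeCoord_left (h.bary_self i)]
  by_cases hkj : k = j
  · rw [hkj, edgeCoord_right (h.bary_pos hij).ne']
  · simpa [subCoord, hki, hkj] using hx k

lemma IsSplit.tip_add_mid_add_edge (h : IsSplit T κ p) {i j : Fin 4} (hij : j ≠ i) (x : E3) :
    tipCoord T i x + midCoord T (p i) i j x + ∑ k, edgeCoord T (p i) i j k x = 1 := by
  have h2 := sum_subCoord_smul hij (h.bary_self i) (h.bary_pos hij).ne' (fun _ => (1 : ℝ)) 1 1 x
  simp only [ite_self, smul_eq_mul, mul_one] at h2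
  rw [← h2, sum_subCoord hij (h.bary_self i) (h.bary_pos hij).ne']

lemma apply_subPoint (v : E3 → E3) (T : Tet) (q : E3) (i j k : Fin 4) :
    v (subPoint T q i j k) =
      if k = i then v T.incenter else if k = j then v q else v (T.points k) := by
  unfold subPoint
  split_ifs <;> rfl

lemma IsSplit.apply_eq (h : IsSplit T κ p) (hv : IsPiecewiseAffine T p v) {i j : Fin 4}
    (hij : j ≠ i) {x : E3} (hx : ∀ k, 0 ≤ subCoord T (p i) i j k x) :
    v x = tipCoord T i x • v T.incenter + midCoord T (p i) i j x • v (p i) +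
      ∑ k, edgeCoord T (p i) i j k x • v (T.points k) := by
  obtain ⟨A, hA⟩ := hv i j hij
  have hp := h.bary_self i
  have hj := (h.bary_pos hij).ne'
  rw [hA (mem_subTet hij hp hj hx), affine_eq_sum_subCoord hij hp hj A x,
    ← sum_subCoord_smul hij hp hj (fun k => v (T.points k))]
  refine Finset.sum_congr rfl fun k _ => ?_
  rw [← hA (subPoint_mem T _ i j k), apply_subPoint v]

/-- The value of a field at a split point, tested with the normal, is controlled by the flux. -/
lemma IsSplit.abs_inner_le (h : IsSplit T κ p) (hv : IsPiecewiseAffine T p v)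
    (hc : ContinuousOn v T.closedInterior) {a : ℝ} (ha : ∀ k, ‖v (T.points k)‖ ≤ a) (i : Fin 4) :
    |inner ℝ (outwardNormal T i) (v (p i))| ≤
      8 / (κ * T.inradius) ^ 2 * (|faceFlux T v i| + a * (4 * hT T ^ 2)) := by
  have hκ := h.pos
  have hr := T.inradius_pos
  have hh := hT_pos T
  have ha0 : 0 ≤ a := (norm_nonneg _).trans (ha 0)
  set δ := κ * T.inradius / 2 with hδ
  have hδ0 : 0 < δ := by positivity
  -- Within distance κ r / 2 of `p i` each λ_j changes by at most κ / 2, which is at most half of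
  -- its value there.
  have hDF : faceDisc T i (p i) δ ⊆ face T i ∧
      ∀ x ∈ faceDisc T i (p i) δ, ∀ j, j ≠ i → 1 / 2 * bary T j (p i) ≤ bary T j x := by
    have key : ∀ x ∈ faceDisc T i (p i) δ, ∀ j, j ≠ i → 1 / 2 * bary T j (p i) ≤ bary T j x := by
      rintro x ⟨-, hx⟩ j hj
      rw [Metric.mem_closedBall, dist_eq_norm] at hx
      have h1 := abs_baryDeriv_le T j (x - p i)
      rw [← bary_sub] at h1
      have h2 : ‖x - p i‖ / T.inradius ≤ κ / 2 := by
        rw [div_le_iff₀ hr]; linarith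
      linarith [(abs_le.1 h1).1, h.le_bary i j hj]
    refine ⟨fun x hx => (mem_face_iff T i x).2 ⟨fun j => ?_, hx.1⟩, key⟩
    by_cases hj : j = i
    · rw [hj]; exact hx.1.ge
    · exact le_trans (by linarith [h.bary_pos hj]) (key x hx j hj)
  have hμF : (μHE[2] : Measure E3) (face T i) ≤ ENNReal.ofReal (hT T ^ 2 * Real.pi) := by
    rw [← measure_faceDisc T i (h.bary_self i) hh.le]
    exact measure_mono (face_subset_faceDisc T (h.mem i))
  have hμF' : (μHE[2] : Measure E3) (face T i) ≠ ⊤ := (hμF.trans_lt ENNReal.ofReal_lt_top).ne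
  have hμr : (μHE[2] : Measure E3).real (face T i) ≤ hT T ^ 2 * Real.pi :=
    ENNReal.toReal_le_of_le_ofReal (by positivity) hμF
  have hcont : ContinuousOn (fun x => inner ℝ (v x) (outwardNormal T i)) (face T i) :=
    (hc.mono (face_subset T i)).inner continuousOn_const
  have hint : IntegrableOn (fun x => inner ℝ (v x) (outwardNormal T i)) (face T i) μHE[2] := by
    obtain ⟨C, hC⟩ := (isCompact_face T i).exists_bound_of_continuousOn hcont
    exact IntegrableOn.of_bound hμF'.lt_top
      (hcont.aestronglyMeasurable (isCompact_face T i).measurableSet) C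
      ((ae_restrict_iff' (isCompact_face T i).measurableSet).2 (Filter.Eventually.of_forall hC))
  have key := mul_measureReal_le_of_approx (isCompact_face T i).measurableSet
    (isClosed_faceDisc T i (p i) δ).measurableSet hDF.1 hμF' hint
    (c := inner ℝ (outwardNormal T i) (v (p i))) (a := a) (fun x hx => by
      obtain ⟨j, hij, hpos⟩ := h.exists_subCoord_nonneg_of_mem_face hx
      have ht : tipCoord T i x = 0 := by
        rw [tipCoord_apply, ((mem_face_iff T i x).1 hx).2, mul_zero]
      have hm0 : 0 ≤ midCoord T (p i) i j x := by simpa [subCoord, hij] using hpos j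
      -- On the face the incenter's coordinate vanishes. So the normal component is `midCoord` times
      -- its value at `p i`, plus vertex values with nonnegative weights of total at most 1.
      refine ⟨midCoord T (p i) i j x, hm0, fun hxD => ?_, ?_⟩
      · rw [midCoord_apply, ht, mul_zero, sub_zero, ← div_eq_inv_mul,
          le_div_iff₀ (h.bary_pos hij)]
        exact hDF.2 x hxD j hij
      · rw [h.apply_eq hv hij hpos, ht, zero_smul, zero_add, real_inner_comm, inner_add_right,
          real_inner_smul_right, add_sub_cancel_left]
        refine (abs_inner_outwardNormal_le T i _).trans ((norm_sum_le _ _).trans ?_)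
        have hs := h.tip_add_mid_add_edge hij x
        calc ∑ k, ‖edgeCoord T (p i) i j k x • v (T.points k)‖
            ≤ ∑ k, edgeCoord T (p i) i j k x * a := by
              refine Finset.sum_le_sum fun k _ => ?_
              have he := h.edgeCoord_nonneg hij hpos k
              rw [norm_smul, Real.norm_of_nonneg he]
              exact mul_le_mul_of_nonneg_left (ha k) he
          _ ≤ a := by
              rw [← Finset.sum_mul]
              exact mul_le_of_le_one_left ha0 (by linarith))
  rw [measure_real_faceDisc T i (h.bary_self i) hδ0.le] at key
  change _ ≤ |faceFlux T v i| + _ at key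
  have hπ := Real.pi_gt_three
  have hπ4 := Real.pi_le_four
  set c := |inner ℝ (outwardNormal T i) (v (p i))| with hcd
  have hc0 : 0 ≤ c := abs_nonneg _
  have h1 : c * (δ ^ 2 / 2) ≤ |faceFlux T v i| + a * (4 * hT T ^ 2) := by
    have e1 : c * (δ ^ 2 / 2) ≤ c * (δ ^ 2 * Real.pi / 2) := by
      gcongr
      nlinarith [sq_nonneg δ]
    have e2 : a * (μHE[2] : Measure E3).real (face T i) ≤ a * (4 * hT T ^ 2) := by
      refine mul_le_mul_of_nonneg_left (hμr.trans ?_) ha0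
      nlinarith [sq_nonneg (hT T)]
    linarith
  calc c = 8 / (κ * T.inradius) ^ 2 * (c * (δ ^ 2 / 2)) := by
        rw [hδ]; field_simp; norm_num
    _ ≤ _ := by gcongr

/-- A field is bounded on the tetrahedron by its nodal values. -/
lemma IsSplit.norm_apply_le (h : IsSplit T κ p) (hv : IsPiecewiseAffine T p v) {N : ℝ}
    (hN : ∀ i j k, ‖v (subPoint T (p i) i j k)‖ ≤ N) {x : E3} (hx : x ∈ T.closedInterior) :
    ‖v x‖ ≤ N := by
  obtain ⟨i, j, hij, hpos⟩ := h.exists_subCoord_nonneg hx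
  obtain ⟨A, hA⟩ := hv i j hij
  have hp := h.bary_self i
  have hj := (h.bary_pos hij).ne'
  rw [hA (mem_subTet hij hp hj hpos), affine_eq_sum_subCoord hij hp hj A x]
  refine (norm_sum_le _ _).trans ?_
  calc _ ≤ ∑ k, subCoord T (p i) i j k x * N := by
        refine Finset.sum_le_sum fun k _ => ?_
        rw [norm_smul, Real.norm_of_nonneg (hpos k), ← hA (subPoint_mem T _ i j k)]
        exact mul_le_mul_of_nonneg_left (hN i j k) (hpos k)
    _ = N := by rw [← Finset.sum_mul, sum_subCoord hij hp hj, one_mul]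

end PiecewiseAffine

/-! ### Derivatives and the L² norm of the divergence. -/

section Derivative

variable {T : Tet} {κ : ℝ} {p : Fin 4 → E3} {v : E3 → E3}

lemma hasFDerivAt_affineMap (A : E3 →ᵃ[ℝ] E3) (x : E3) :
    HasFDerivAt A (LinearMap.toContinuousLinearMap A.linear) x := by
  have h := ((LinearMap.toContinuousLinearMap A.linear).hasFDerivAt (x := x)).add_const (A 0)
  rw [A.decomp]
  exact h

lemma IsSplit.fderiv_apply (h : IsSplit T κ p) (hv : IsPiecewiseAffine T p v) {i j : Fin 4}
    (hij : j ≠ i) {x : E3} (hx : x ∈ interior (subTet T (p i) i j)) (y : E3) :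
    fderiv ℝ v x y =
      ∑ k, (subCoord T (p i) i j k).linear y • v (subPoint T (p i) i j k) := by
  obtain ⟨A, hA⟩ := hv i j hij
  have hev : v =ᶠ[nhds x] A :=
    Filter.eventuallyEq_of_mem (isOpen_interior.mem_nhds hx) (hA.mono interior_subset)
  rw [hev.fderiv_eq, (hasFDerivAt_affineMap A x).fderiv, LinearMap.coe_toContinuousLinearMap',
    affine_linear_eq_sum_subCoord hij (h.bary_self i) (h.bary_pos hij).ne' A y]
  exact Finset.sum_congr rfl fun k _ => by rw [← hA (subPoint_mem T _ i j k)]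

lemma IsSplit.abs_partialDeriv_le (h : IsSplit T κ p) (hv : IsPiecewiseAffine T p v) {N : ℝ}
    (hN : ∀ i j k, ‖v (subPoint T (p i) i j k)‖ ≤ N) {i j : Fin 4} (hij : j ≠ i) {x : E3}
    (hx : x ∈ interior (subTet T (p i) i j)) (a b : Fin 3) :
    |partialDeriv v a b x| ≤ 16 * N / (κ * T.inradius) := by
  have hκ := h.pos
  have hr := T.inradius_pos
  rw [partialDeriv, h.fderiv_apply hv hij hx]
  have hcomp : ∀ w : E3, |w a| ≤ ‖w‖ := fun w => PiLp.norm_apply_le w a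
  refine (hcomp _).trans ((norm_sum_le _ _).trans ?_)
  calc _ ≤ ∑ k : Fin 4, 4 / (κ * T.inradius) * N := by
        refine Finset.sum_le_sum fun k _ => ?_
        rw [norm_smul, Real.norm_eq_abs]
        have h1 := h.abs_subCoord_linear_le hij k (EuclideanSpace.single b (1 : ℝ))
        rw [PiLp.norm_single, norm_one, mul_one] at h1
        exact mul_le_mul h1 (hN i j k) (norm_nonneg _) (by positivity)
    _ = _ := by simp; ring

/-- The constant divergence on a tetrahedron of the split. -/
lemma IsSplit.divergence_eq (h : IsSplit T κ p) (hv : IsPiecewiseAffine T p v) {i j : Fin 4}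
    (hij : j ≠ i) {x : E3} (hx : x ∈ interior (subTet T (p i) i j)) :
    divergence v x =
      ∑ k, (subCoord T (p i) i j k).linear (v (subPoint T (p i) i j k)) := by
  simp only [divergence, partialDeriv, h.fderiv_apply hv hij hx, WithLp.ofLp_sum, Finset.sum_apply,
    WithLp.ofLp_smul, Pi.smul_apply, smul_eq_mul]
  rw [Finset.sum_comm]
  refine Finset.sum_congr rfl fun k _ => ?_
  generalize v (subPoint T (p i) i j k) = w
  conv_rhs => rw [← (EuclideanSpace.basisFun (Fin 3) ℝ).sum_repr w]
  simp [mul_comm]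

/-- The subtetrahedra cover `T` and convex sets have null frontier. So the pointwise derivative,
which is only known in the interiors, is known almost everywhere. -/
lemma IsSplit.ae_mem_interior (h : IsSplit T κ p) :
    ∀ᵐ x ∂volume.restrict T.closedInterior,
      ∃ i j, j ≠ i ∧ x ∈ interior (subTet T (p i) i j) := by
  rw [ae_restrict_iff' T.isCompact_closedInterior.measurableSet]
  have hfr : ∀ i j, ∀ᵐ x : E3, x ∉ frontier (subTet T (p i) i j) := fun i j =>
    measure_eq_zero_iff_ae_notMem.1 ((convex_convexHull ℝ _).addHaar_frontier volume)
  have hall : ∀ᵐ x : E3, ∀ i j, x ∉ frontier (subTet T (p i) i j) :=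
    ae_all_iff.2 fun i => ae_all_iff.2 fun j => hfr i j
  filter_upwards [hall] with x hx hxT
  obtain ⟨i, j, hij, hpos⟩ := h.exists_subCoord_nonneg hxT
  refine ⟨i, j, hij, ?_⟩
  have h1 := mem_subTet hij (h.bary_self i) (h.bary_pos hij).ne' hpos
  by_contra h2
  exact hx i j ⟨subset_closure h1, h2⟩

lemma measurable_divergence (v : E3 → E3) : Measurable (divergence v) := by
  refine Finset.measurable_fun_sum _ fun i _ => ?_
  exact (EuclideanSpace.proj i : E3 →L[ℝ] ℝ).measurable.comp
    (measurable_fderiv_apply_const ℝ v (EuclideanSpace.single i 1))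

lemma measure_closedInterior_lt_top (T : Tet) : volume T.closedInterior < ⊤ :=
  T.isCompact_closedInterior.measure_lt_top

lemma measureReal_closedBall (z : E3) {ρ : ℝ} (hρ : 0 ≤ ρ) :
    volume.real (Metric.closedBall z ρ) = ρ ^ 3 * (Real.pi * 4 / 3) := by
  rw [measureReal_def, EuclideanSpace.volume_closedBall_fin_three, ENNReal.toReal_mul,
    ENNReal.toReal_pow, ENNReal.toReal_ofReal hρ, ENNReal.toReal_ofReal (by positivity)]

lemma measureReal_closedInterior_le (T : Tet) : volume.real T.closedInterior ≤ 6 * hT T ^ 3 := by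
  have hh := hT_pos T
  have h1 : T.closedInterior ⊆ Metric.closedBall T.incenter (hT T) := fun x hx =>
    dist_le_hT T hx (incenter_mem T)
  refine (measureReal_mono h1 measure_closedBall_lt_top.ne).trans ?_
  rw [measureReal_closedBall _ hh.le, mul_comm]
  gcongr
  linarith [Real.pi_le_four]

/-- The divergence on each tetrahedron of the split is controlled by its `L²` norm. -/
lemma IsSplit.sq_sum_le (h : IsSplit T κ p) (hv : IsPiecewiseAffine T p v) {i j : Fin 4}
    (hij : j ≠ i) :
    (∑ k, (subCoord T (p i) i j k).linear (v (subPoint T (p i) i j k))) ^ 2 *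
      (4 * (κ * T.inradius / 16) ^ 3) ≤ ∫ x in T.closedInterior, divergence v x ^ 2 := by
  have hκ := h.pos
  have hr := T.inradius_pos
  set ρ := κ * T.inradius / 16 with hρ
  have hρ0 : 0 < ρ := by positivity
  set z : E3 := ∑ l, (1 / 4 : ℝ) • subPoint T (p i) i j l
  set D := ∑ k, (subCoord T (p i) i j k).linear (v (subPoint T (p i) i j k))
  have hball : Metric.ball z ρ ⊆ interior (subTet T (p i) i j) :=
    interior_maximal (Metric.ball_subset_closedBall.trans (h.closedBall_subset hij))
      Metric.isOpen_ball
  have hballT : Metric.ball z ρ ⊆ T.closedInterior :=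
    (hball.trans interior_subset).trans (h.subTet_subset i j)
  obtain ⟨N, hN⟩ : ∃ N, ∀ i j k, ‖v (subPoint T (p i) i j k)‖ ≤ N := by
    obtain ⟨N, hN⟩ := Finite.exists_le fun t : Fin 4 × Fin 4 × Fin 4 =>
      ‖v (subPoint T (p t.1) t.1 t.2.1 t.2.2)‖
    exact ⟨N, fun i j k => hN (i, j, k)⟩
  -- Without integrability the integral over `T` would be 0 by default and could not dominate the
  -- one over the ball. The bound N serves only this purpose and does not enter the estimate.
  have hint : IntegrableOn (fun x => divergence v x ^ 2) T.closedInterior := by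
    refine IntegrableOn.of_bound (measure_closedInterior_lt_top T)
      ((measurable_divergence v).pow_const 2).aestronglyMeasurable
      ((3 * (16 * N / (κ * T.inradius))) ^ 2) ?_
    filter_upwards [h.ae_mem_interior] with x ⟨i', j', hij', hx⟩
    rw [norm_pow]
    refine pow_le_pow_left₀ (norm_nonneg _) ((norm_sum_le _ _).trans ?_) 2
    calc _ ≤ ∑ a : Fin 3, 16 * N / (κ * T.inradius) :=
          Finset.sum_le_sum fun a _ => h.abs_partialDeriv_le hv hN hij' hx a a
      _ = _ := by simp
  calc D ^ 2 * (4 * ρ ^ 3) ≤ D ^ 2 * volume.real (Metric.ball z ρ) := by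
        gcongr
        rw [measureReal_def, ← Measure.addHaar_closedBall_eq_addHaar_ball, ← measureReal_def,
          measureReal_closedBall _ hρ0.le, mul_comm]
        gcongr
        linarith [Real.pi_gt_three]
    _ = ∫ x in Metric.ball z ρ, divergence v x ^ 2 := by
        rw [setIntegral_congr_fun (g := fun _ => D ^ 2) measurableSet_ball fun x hx => by
          rw [h.divergence_eq hv hij (hball hx)], setIntegral_const, smul_eq_mul, mul_comm]
    _ ≤ _ := setIntegral_mono_set hint
        (Filter.Eventually.of_forall fun x => sq_nonneg (divergence v x))
        (Filter.Eventually.of_forall hballT)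

end Derivative

/-! ### The estimate on one tetrahedron. -/

section Estimate

variable {T : Tet} {κ : ℝ} {p : Fin 4 → E3} {v : E3 → E3}

/-- Nodal values are controlled by the vertex values, the fluxes and the divergence. -/
lemma IsSplit.nodal_le (h : IsSplit T κ p) {a d Q : ℝ}
    (ha : ∀ k, ‖v (T.points k)‖ ≤ a)
    (hd : ∀ i j, j ≠ i →
      |∑ k, (subCoord T (p i) i j k).linear (v (subPoint T (p i) i j k))| ≤ d)
    (hQ : ∀ i, |inner ℝ (outwardNormal T i) (v (p i))| ≤ Q) (i j k : Fin 4) :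
    ‖v (subPoint T (p i) i j k)‖ ≤
      a + 8 * hT T * (d + 16 * a / (κ * T.inradius) + Q / T.inradius) := by
  have hκ := h.pos
  have hr := T.inradius_pos
  have hh := hT_pos T
  have ha0 : 0 ≤ a := (norm_nonneg _).trans (ha 0)
  have hd0 : 0 ≤ d := (abs_nonneg _).trans (hd 0 1 (by decide))
  have hQ0 : 0 ≤ Q := (abs_nonneg _).trans (hQ 0)
  have hR : ∀ i j, j ≠ i → |(tipCoord T i).linear (v T.incenter) +
      (midCoord T (p i) i j).linear (v (p i))| ≤ d + 16 * a / (κ * T.inradius) := by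
    intro i j hij
    have h1 := hd i j hij
    have hj : j ∈ Finset.univ.erase i := by simp [hij]
    rw [← Finset.add_sum_erase _ _ (Finset.mem_univ i), ← Finset.add_sum_erase _ _ hj] at h1
    have e1 : (subCoord T (p i) i j i).linear (v (subPoint T (p i) i j i)) =
        (tipCoord T i).linear (v T.incenter) := by simp [subCoord, subPoint]
    have e2 : (subCoord T (p i) i j j).linear (v (subPoint T (p i) i j j)) =
        (midCoord T (p i) i j).linear (v (p i)) := by simp [subCoord, subPoint, hij]
    have h2 : |∑ k ∈ (Finset.univ.erase i).erase j,
        (subCoord T (p i) i j k).linear (v (subPoint T (p i) i j k))| ≤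
          16 * a / (κ * T.inradius) := by
      refine (Finset.abs_sum_le_sum_abs _ _).trans ?_
      calc _ ≤ ∑ k ∈ (Finset.univ.erase i).erase j, 4 / (κ * T.inradius) * a := by
            refine Finset.sum_le_sum fun k hk => ?_
            simp only [Finset.mem_erase, Finset.mem_univ, and_true] at hk
            refine (h.abs_subCoord_linear_le hij k _).trans ?_
            gcongr
            simpa [subPoint, hk.1, hk.2] using ha k
        _ ≤ ∑ k : Fin 4, 4 / (κ * T.inradius) * a :=
            Finset.sum_le_sum_of_subset_of_nonneg (Finset.subset_univ _)
              fun _ _ _ => by positivity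
        _ = _ := by simp; ring
    rw [e1, e2, ← add_assoc] at h1
    have h3 := abs_sub_abs_le_abs_sub ((tipCoord T i).linear (v T.incenter) +
      (midCoord T (p i) i j).linear (v (p i))) (-∑ k ∈ (Finset.univ.erase i).erase j,
        (subCoord T (p i) i j k).linear (v (subPoint T (p i) i j k)))
    rw [sub_neg_eq_add, abs_neg] at h3
    linarith
  obtain ⟨h1, h2⟩ := h.norm_le (v T.incenter) (fun i => v (p i)) hR hQ
  rw [apply_subPoint v]
  split_ifs
  · linarith
  · linarith [h2 i]
  · have : 0 ≤ 8 * hT T * (d + 16 * a / (κ * T.inradius) + Q / T.inradius) := by positivity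
    linarith [ha k]

/-- The scaled form of the nodal estimate. -/
lemma IsSplit.nodal_le_mul (h : IsSplit T κ p) (hv : IsPiecewiseAffine T p v)
    (hc : ContinuousOn v T.closedInterior) {K τ X : ℝ} (hK : κ * K = 1)
    (hτ : hT T ≤ τ * T.inradius) (hX : 0 ≤ X) (ha : ∀ k, ‖v (T.points k)‖ ≤ X)
    (hf : ∀ i, |faceFlux T v i| ≤ hT T ^ 2 * X)
    (hd : ∫ x in T.closedInterior, divergence v x ^ 2 ≤ hT T * X ^ 2) (i j k : Fin 4) :
    ‖v (subPoint T (p i) i j k)‖ ≤ 705 * K ^ 2 * τ ^ 3 * X := by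
  have hκ := h.pos
  have hr := T.inradius_pos
  have hh := hT_pos T
  have hK1 : 1 ≤ K := by nlinarith [h.le_one]
  have hτ1 : 1 ≤ τ := by
    have := (inradius_le_height T 0).trans (height_le_hT T 0)
    by_contra! hlt
    nlinarith
  have hK0 : 0 < K := by linarith
  have hτ0 : 0 < τ := by linarith
  have hκK : κ = 1 / K := by field_simp; linarith
  have hir : 1 / T.inradius ≤ τ / hT T := by
    rw [div_le_div_iff₀ hr hh]; linarith
  have hd' : ∀ i j, j ≠ i →
      |∑ k, (subCoord T (p i) i j k).linear (v (subPoint T (p i) i j k))| ≤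
        32 * K ^ 2 * τ ^ 2 * X / hT T := by
    intro i j hij
    have h1 := (h.sq_sum_le hv hij).trans hd
    rw [hκK] at h1
    set D := ∑ k, (subCoord T (p i) i j k).linear (v (subPoint T (p i) i j k))
    -- The factor is 1024 = 16³ / 4; K³ τ³ is enlarged to K⁴ τ⁴ so that the square root is the clean
    -- 32 K² τ².
    refine abs_le_of_sq_le_sq ?_ (by positivity)
    calc D ^ 2 = D ^ 2 * (4 * (1 / K * T.inradius / 16) ^ 3) *
          (1024 * K ^ 3 * (1 / T.inradius) ^ 3) := by field_simp; ring
      _ ≤ hT T * X ^ 2 * (1024 * K ^ 3 * (τ / hT T) ^ 3) := by gcongr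
      _ = 1024 * K ^ 3 * τ ^ 3 * (X / hT T) ^ 2 := by field_simp
      _ ≤ 1024 * K ^ 4 * τ ^ 4 * (X / hT T) ^ 2 := by
          gcongr <;> norm_num
      _ = _ := by ring
  have hQ : ∀ i, |inner ℝ (outwardNormal T i) (v (p i))| ≤ 40 * K ^ 2 * τ ^ 2 * X := by
    intro i
    refine (h.abs_inner_le hv hc ha i).trans ?_
    calc _ ≤ 8 / (κ * T.inradius) ^ 2 * (hT T ^ 2 * X + X * (4 * hT T ^ 2)) := by
          gcongr
          exact hf i
      _ = 40 * K ^ 2 * (1 / T.inradius) ^ 2 * (hT T ^ 2 * X) := by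
          rw [hκK]; field_simp; ring
      _ ≤ 40 * K ^ 2 * (τ / hT T) ^ 2 * (hT T ^ 2 * X) := by gcongr
      _ = _ := by field_simp
  refine (h.nodal_le ha hd' hQ i j k).trans ?_
  have e1 : 16 * X / (κ * T.inradius) ≤ 16 * K * τ * X / hT T := by
    calc _ = 16 * X * K * (1 / T.inradius) := by rw [hκK]; field_simp
      _ ≤ 16 * X * K * (τ / hT T) := by gcongr
      _ = _ := by ring
  have e2 : 40 * K ^ 2 * τ ^ 2 * X / T.inradius ≤ 40 * K ^ 2 * τ ^ 3 * X / hT T := by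
    calc _ = 40 * K ^ 2 * τ ^ 2 * X * (1 / T.inradius) := by ring
      _ ≤ 40 * K ^ 2 * τ ^ 2 * X * (τ / hT T) := by gcongr
      _ = _ := by ring
  -- Here 705 = 1 + 8 · (32 + 16 + 40), all powers being raised to K² τ³.
  calc _ ≤ X + 8 * hT T * (32 * K ^ 2 * τ ^ 2 * X / hT T + 16 * K * τ * X / hT T +
        40 * K ^ 2 * τ ^ 3 * X / hT T) := by gcongr
    _ = (1 + 256 * (K ^ 2 * τ ^ 2) + 128 * (K * τ) + 320 * (K ^ 2 * τ ^ 3)) * X := by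
        field_simp; ring
    _ ≤ _ := by
        have f1 : 1 ≤ K ^ 2 * τ ^ 3 := one_le_mul_of_one_le_of_one_le
          (one_le_pow₀ hK1) (one_le_pow₀ hτ1)
        have f2 : K ^ 2 * τ ^ 2 ≤ K ^ 2 * τ ^ 3 := by gcongr; norm_num
        have f3 : K * τ ≤ K ^ 2 * τ ^ 3 := by
          gcongr
          · exact le_self_pow₀ hK1 (by norm_num)
          · exact le_self_pow₀ hτ1 (by norm_num)
        gcongr
        linarith

lemma IsSplit.seminormSq_zero_le (h : IsSplit T κ p) (hv : IsPiecewiseAffine T p v) {N : ℝ}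
    (hN : ∀ i j k, ‖v (subPoint T (p i) i j k)‖ ≤ N) :
    seminormSq T v 0 ≤ N ^ 2 * (6 * hT T ^ 3) := by
  have h1 := norm_setIntegral_le_of_norm_le_const (f := fun x => ‖v x‖ ^ 2) (C := N ^ 2)
    (measure_closedInterior_lt_top T) (fun x hx => by
      rw [norm_pow, norm_norm]
      exact pow_le_pow_left₀ (norm_nonneg _) (h.norm_apply_le hv hN hx) 2)
  exact (Real.le_norm_self _).trans (h1.trans
    (mul_le_mul_of_nonneg_left (measureReal_closedInterior_le T) (sq_nonneg N)))

lemma IsSplit.seminormSq_one_le (h : IsSplit T κ p) (hv : IsPiecewiseAffine T p v) {N : ℝ}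
    (hN : ∀ i j k, ‖v (subPoint T (p i) i j k)‖ ≤ N) :
    seminormSq T v 1 ≤ 9 * (16 * N / (κ * T.inradius)) ^ 2 * (6 * hT T ^ 3) := by
  have h1 := norm_setIntegral_le_of_norm_le_const_ae
    (f := fun x => ∑ i, ∑ j, partialDeriv v i j x ^ 2)
    (C := 9 * (16 * N / (κ * T.inradius)) ^ 2) (measure_closedInterior_lt_top T) (by
      filter_upwards [h.ae_mem_interior] with x ⟨i, j, hij, hx⟩
      rw [Real.norm_of_nonneg (by positivity)]
      calc _ ≤ ∑ a : Fin 3, ∑ b : Fin 3, (16 * N / (κ * T.inradius)) ^ 2 :=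
            Finset.sum_le_sum fun a _ => Finset.sum_le_sum fun b _ => by
              rw [← sq_abs]
              exact pow_le_pow_left₀ (abs_nonneg _) (h.abs_partialDeriv_le hv hN hij hx a b) 2
        _ = _ := by simp; ring)
  exact (Real.le_norm_self _).trans (h1.trans
    (mul_le_mul_of_nonneg_left (measureReal_closedInterior_le T) (by positivity)))

/-- The estimate on a single tetrahedron. -/
lemma IsSplit.seminormSq_le (h : IsSplit T κ p) (hv : IsPiecewiseAffine T p v)
    (hc : ContinuousOn v T.closedInterior) {K τ X : ℝ} (hK : κ * K = 1)
    (hτ : hT T ≤ τ * T.inradius) (hX : 0 ≤ X) (ha : ∀ k, ‖v (T.points k)‖ ≤ X)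
    (hf : ∀ i, |faceFlux T v i| ≤ hT T ^ 2 * X)
    (hd : ∫ x in T.closedInterior, divergence v x ^ 2 ≤ hT T * X ^ 2) (m : Fin 2) :
    seminormSq T v m ≤ 13824 * (K * τ) ^ 2 * (705 * K ^ 2 * τ ^ 3) ^ 2 *
      hT T ^ (-1 - 2 * ((m : ℕ) : ℤ)) * (hT T ^ 4 * X ^ 2) := by
  have hN := h.nodal_le_mul hv hc hK hτ hX ha hf hd
  have hκ := h.pos
  have hr := T.inradius_pos
  have hh := hT_pos T
  have hK1 : 1 ≤ K := by nlinarith [h.le_one]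
  have hτ1 : 1 ≤ τ := by
    have := (inradius_le_height T 0).trans (height_le_hT T 0)
    by_contra! hlt
    nlinarith
  have hKτ : 1 ≤ (K * τ) ^ 2 := one_le_pow₀ (one_le_mul_of_one_le_of_one_le hK1 hτ1)
  have hK0 : 0 < K := by linarith
  have hκK : κ = 1 / K := by field_simp; linarith
  have hir : 1 / T.inradius ≤ τ / hT T := by
    rw [div_le_div_iff₀ hr hh]; linarith
  set c := 705 * K ^ 2 * τ ^ 3 with hcdef
  have hc0 : 0 ≤ c := by positivity
  -- The constant 13824 = 9 · 16² · 6 is the one needed for m = 1; m = 0 would need only 6.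
  fin_cases m
  · refine (h.seminormSq_zero_le hv hN).trans ?_
    have e : hT T ^ (-1 - 2 * (((0 : Fin 2) : ℕ) : ℤ)) = (hT T)⁻¹ := by simp
    change _ ≤ 13824 * (K * τ) ^ 2 * c ^ 2 * hT T ^ (-1 - 2 * (((0 : Fin 2) : ℕ) : ℤ)) * _
    rw [e]
    calc (c * X) ^ 2 * (6 * hT T ^ 3) ≤ (13824 * (K * τ) ^ 2) * ((c * X) ^ 2 * hT T ^ 3) := by
          have : 0 ≤ (c * X) ^ 2 * hT T ^ 3 := by positivity
          nlinarith
      _ = _ := by field_simp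
  · refine (h.seminormSq_one_le hv hN).trans ?_
    have e : hT T ^ (-1 - 2 * (((1 : Fin 2) : ℕ) : ℤ)) = (hT T ^ 3)⁻¹ := by
      rw [← zpow_natCast, ← zpow_neg]; norm_num
    change _ ≤ 13824 * (K * τ) ^ 2 * c ^ 2 * hT T ^ (-1 - 2 * (((1 : Fin 2) : ℕ) : ℤ)) * _
    rw [e]
    calc _ = 9 * (16 * (c * X) * K * (1 / T.inradius)) ^ 2 * (6 * hT T ^ 3) := by
          rw [hκK]; field_simp
      _ ≤ 9 * (16 * (c * X) * K * (τ / hT T)) ^ 2 * (6 * hT T ^ 3) := by gcongr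
      _ = _ := by field_simp; ring

end Estimate

/-! ### From the mesh to the local split. -/

section Mesh

variable {σ : ℝ}

/-- Split points of the faces of a tetrahedron of a shape regular mesh. -/
lemma exists_isSplit (M : TetMesh) (hM : M.ShapeRegular σ) {T : Tet} (hTM : T ∈ M.tets) :
    ∃ p : Fin 4 → E3, IsSplit T (1 / (16 * σ ^ 3)) p ∧ ∀ i, M.IsFaceSplitPoint T i (p i) := by
  choose p h1 h2 h3 using exists_isFaceSplitPoint M hM hTM
  have hσ := sigma_pos (hM T hTM)
  exact ⟨p, ⟨by positivity, h2, h3⟩, h1⟩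

lemma isPiecewiseAffine_of_mem (M : TetMesh) {T : Tet} (hTM : T ∈ M.tets) {p : Fin 4 → E3}
    (hp : ∀ i, M.IsFaceSplitPoint T i (p i)) {v : E3 → E3} (hv : v ∈ M.lagrangeSpace) :
    IsPiecewiseAffine T p v := fun i j hij =>
  hv.2 _ (Set.mem_biUnion hTM ⟨i, j, p i, hij, hp i, (convexHull_eq_subTet T (p i) hij).symm⟩)

end Mesh

end WorseyFarin

/-! ### The theorem for all shape regular meshes. -/

theorem mainTheorem6 (σ : ℝ) :
    ∃ C : ℝ, 0 < C ∧
      ∀ M : WorseyFarin.TetMesh, M.ShapeRegular σ →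
        ∀ v ∈ M.lagrangeSpace, ∀ T ∈ M.tets, ∀ m : Fin 2,
          WorseyFarin.seminormSq T v m ≤
            C * WorseyFarin.hT T ^ (-1 - 2 * ((m : ℕ) : ℤ)) *
              (WorseyFarin.hT T ^ 4 * ∑ a, ‖v (T.points a)‖ ^ 2
                + ∑ i, |WorseyFarin.faceFlux T v i| ^ 2
                + WorseyFarin.hT T ^ 3 *
                    ∫ x in T.closedInterior, WorseyFarin.divergence v x ^ 2) := by
  open WorseyFarin in
  -- This is the local constant with K = 1/κ = 16 σ³ and τ = 2σ. The added 1 keeps it positive for σ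
  -- = 0, where no tetrahedron is admissible.
  refine ⟨13824 * (16 * σ ^ 3 * (2 * σ)) ^ 2 * (705 * (16 * σ ^ 3) ^ 2 * (2 * σ) ^ 3) ^ 2 + 1,
    by positivity, fun M hM v hv T hTM m => ?_⟩
  obtain ⟨p, hp, hps⟩ := exists_isSplit M hM hTM
  have hpw := isPiecewiseAffine_of_mem M hTM hps hv
  have hcont : ContinuousOn v T.closedInterior := hv.1.mono (Set.subset_biUnion_of_mem hTM)
  have hσ := sigma_pos (hM T hTM)
  have hh := hT_pos T
  have hτ : hT T ≤ 2 * σ * T.inradius := by linarith [hM T hTM]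
  set S := ∑ a, ‖v (T.points a)‖ ^ 2 with hS
  set G := ∑ i, |faceFlux T v i| ^ 2 with hG
  set I := ∫ x in T.closedInterior, divergence v x ^ 2 with hI
  have hS0 : 0 ≤ S := by positivity
  have hG0 : 0 ≤ G := by positivity
  have hI0 : 0 ≤ I := integral_nonneg fun x => sq_nonneg _
  set E := hT T ^ 4 * S + G + hT T ^ 3 * I with hE
  have hE0 : 0 ≤ E := by positivity
  have hS1 : 0 ≤ hT T ^ 4 * S := by positivity
  have hI1 : 0 ≤ hT T ^ 3 * I := by positivity
  -- With h_T⁴ X² equal to the whole bracket, each of its three terms gives one hypothesis of the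
  -- local estimate in terms of the single quantity X.
  obtain ⟨X, hX0, hX⟩ : ∃ X : ℝ, 0 ≤ X ∧ hT T ^ 4 * X ^ 2 = E :=
    ⟨√E / hT T ^ 2, by positivity, by rw [div_pow, Real.sq_sqrt hE0]; field_simp⟩
  have hkey := hp.seminormSq_le hpw hcont (K := 16 * σ ^ 3) (τ := 2 * σ) (X := X)
    (by field_simp) hτ hX0
    (fun k => by
      refine le_of_sq_le_sq ?_ hX0
      refine le_of_mul_le_mul_left ?_ (pow_pos hh 4)
      have : ‖v (T.points k)‖ ^ 2 ≤ S :=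
        Finset.single_le_sum (f := fun a => ‖v (T.points a)‖ ^ 2) (fun _ _ => sq_nonneg _)
          (Finset.mem_univ k)
      rw [hX]
      nlinarith [mul_le_mul_of_nonneg_left this (pow_pos hh 4).le])
    (fun i => by
      refine le_of_sq_le_sq ?_ (by positivity)
      have : |faceFlux T v i| ^ 2 ≤ G :=
        Finset.single_le_sum (f := fun a => |faceFlux T v a| ^ 2) (fun _ _ => sq_nonneg _)
          (Finset.mem_univ i)
      rw [mul_pow, ← pow_mul, hX]
      linarith)
    (by
      refine le_of_mul_le_mul_left ?_ (pow_pos hh 3)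
      rw [← mul_assoc, ← pow_succ, hX]
      linarith) m
  rw [hX] at hkey
  refine hkey.trans ?_
  have : 0 ≤ hT T ^ (-1 - 2 * ((m : ℕ) : ℤ)) := (zpow_pos hh _).le
  gcongr
  linarith
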